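/- Let $N\ge 1$, $\beta\in(0,1)$ and let $\vec a=(a_1<\dots<a_N)\in\mathbb Z^N$. Let $\mathbb W^N=\{\vec x\in\mathbb Z^N: x_1<\dots<x_N\}$, and for $\vec x\in\mathbb W^N$ put $|\vec x|=x_1+\dots+x_N$ and $\mathsf V(\vec x)=\prod_{1\le j<i\le N}(x_i-x_j)$. The noncolliding Bernoulli random walk with parameter $\beta$ started from $\vec a$ is the Markov chain $\vec X(t)$, $t\in\mathbb Z_{\ge 0}$, on $\mathbb W^N$ with $\vec X(0)=\vec a$ and transition probabilities $$\mathbb P\big(\vec X(t+1)=\vec x'\mid \vec X(t)=\vec x\big)=\frac{\mathsf V(\vec x')}{\mathsf V(\vec x)}\,\beta^{|\vec x'|-|\vec x|}(1-\beta)^{N-|\vec x'|+|\vec x|}$$ if $x_i'-x_i\in\{0,1\}$ for all $i$, and $0$ otherwise. Then $\vec X$ is dynamically determinantal: there is a kernel $K(t,x;s,y)$, with $t,s\in\mathbb Z_{\ge0}$ and $x,y\in\mathbb Z$, such that for all $k$ and all pairwise distinct space-time points $(t_1,y_1),\dots,(t_k,y_k)\in\mathbb Z_{\ge 0}\times\mathbb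 Z$, $$\mathbb P\big(y_i\in\{X_1(t_i),\dots,X_N(t_i)\}\text{ for all }i=1,\dots,k\big)=\det\big[K(t_\alpha,y_\alpha;t_\gamma,y_\gamma)\big]_{\alpha,\gamma=1}^k .$$ Moreover, for all $t_1,t_2\in\mathbb Z_{\ge1}$ and $x_1,x_2\in\mathbb Z$, $$K(t_1,x_1;t_2,x_2)=\mathbf 1_{x_1\ge x_2}\mathbf 1_{t_1>t_2}(-1)^{x_1-x_2+1}\binom{t_1-t_2}{x_1-x_2}$$ $$\qquad+\frac{t_1!}{(t_2-1)!}\frac1{(2\pi \mathrm i)^2}\int_{x_2-t_2+\frac12-\mathrm i\infty}^{x_2-t_2+\frac12+\mathrm i\infty}dz\oint dw\;\frac{(z-x_2+1)_{t_2-1}}{(w-x_1)_{t_1+1}}\,\frac1{w-z}\,\frac{\sin(\pi w)}{\sin(\pi z)}\Big(\frac{1-\beta}{\beta}\Big)^{w-z}\prod_{r=1}^N\frac{z-a_r}{w-a_r},$$ where $(u)_k=u(u+1)\cdots(u+k-1)$ and the integrals converge. Here $z$ runs upwards over the vertical line $\Re z=x_2-t_2+\frac12$, and the $w$ contour is any positively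 oriented circle, or union of two circles, with the following properties: each circle lies together with its interior strictly on one side of the $z$ line, with at most one circle on each side; no circle passes through an integer; and the circles together encircle all the $w$ poles $\{x_1-t_1,x_1-t_1+1,\dots,x_1\}\cap\{a_1,\dots,a_N\}$ of the integrand other than $w=z$. (If there are no such poles, the double integral is zero.) -/

import Mathlib

open MeasureTheory

namespace NoncollidingBernoulli

noncomputable section

/-- The Weyl chamber `x₁ < x₂ < … < x_N` in `ℤ^N`. -/
abbrev Weyl (N : ℕ) : Type := {x : Fin N → ℤ // StrictMono x}

/-- The Vandermonde product `∏_{j < i} (x_i - x_j)`. -/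
def vandermonde {N : ℕ} (x : Weyl N) : ℝ :=
  ∏ i : Fin N, ∏ j ∈ Finset.Iio i, ((x.1 i : ℝ) - (x.1 j : ℝ))

/-- `|x| = x₁ + … + x_N`. -/
def total {N : ℕ} (x : Weyl N) : ℤ := ∑ i, x.1 i

/-- One-step transition probabilities of the noncolliding Bernoulli random walk. -/
def transition {N : ℕ} (β : ℝ) (x x' : Weyl N) : ℝ :=
  if ∀ i, x'.1 i - x.1 i = 0 ∨ x'.1 i - x.1 i = 1 then
    vandermonde x' / vandermonde x *
      β ^ (total x' - total x) * (1 - β) ^ ((N : ℤ) - total x' + total x)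
  else 0

/-- `X` is a discrete time Markov chain on the Weyl chamber, started from `a`, whose one-step
transition probabilities are `transition β`. The Markov property is written without division:
`ℙ(X₀ = x₀, …, X_t = x_t, X_{t+1} = x') = ℙ(X₀ = x₀, …, X_t = x_t) · p(x_t, x')`. -/
structure IsWalk {N : ℕ} (β : ℝ) (a : Weyl N) {Ω : Type*} [MeasurableSpace Ω]
    (P : Measure Ω) (X : ℕ → Ω → Weyl N) : Prop where
  measurable : ∀ t, Measurable (X t)
  start : ∀ᵐ ω ∂P, X 0 ω = a
  markov : ∀ (t : ℕ) (x : ℕ → Weyl N) (x' : Weyl N),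
    P.real {ω | (∀ s ≤ t, X s ω = x s) ∧ X (t + 1) ω = x'} =
      P.real {ω | ∀ s ≤ t, X s ω = x s} * transition β (x t) x'

/-- The particle dynamics `X` is dynamically determinantal with space-time correlation kernel
`K(t, x; s, y)`. -/
def IsDeterminantal {N : ℕ} {Ω : Type*} [MeasurableSpace Ω] (P : Measure Ω)
    (X : ℕ → Ω → Weyl N) (K : ℕ → ℤ → ℕ → ℤ → ℂ) : Prop :=
  ∀ (k : ℕ) (t : Fin k → ℕ) (y : Fin k → ℤ),
    Function.Injective (fun i => (t i, y i)) →
    ((P.real {ω | ∀ i, ∃ j, (X (t i) ω).1 j = y i} : ℝ) : ℂ) =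
      Matrix.det (Matrix.of fun i j => K (t i) (y i) (t j) (y j))

/-- The Pochhammer symbol `(z)_k = z (z + 1) ⋯ (z + k - 1)`. -/
def poch (z : ℂ) (k : ℕ) : ℂ := (ascPochhammer ℂ k).eval z

/-- The integrand of the double contour integral. -/
def integrand {N : ℕ} (β : ℝ) (a : Weyl N) (t₁ : ℕ) (x₁ : ℤ) (t₂ : ℕ) (x₂ : ℤ)
    (z w : ℂ) : ℂ :=
  poch (z - x₂ + 1) (t₂ - 1) / poch (w - x₁) (t₁ + 1) *
    (1 / (w - z)) *
    (Complex.sin (Real.pi * w) / Complex.sin (Real.pi * z)) *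
    (((1 - β) / β : ℝ) : ℂ) ^ (w - z) *
    ∏ r : Fin N, (z - (a.1 r : ℂ)) / (w - (a.1 r : ℂ))

/-- The point with ordinate `u` on the vertical line `Re z = x₂ - t₂ + 1/2`. -/
def linePoint (t₂ : ℕ) (x₂ : ℤ) (u : ℝ) : ℂ :=
  ((x₂ : ℂ) - (t₂ : ℂ) + 1 / 2) + u * Complex.I

/-- The `w` poles `{x₁ - t₁, …, x₁} ∩ {a₁, …, a_N}` of the integrand, other than `w = z`. -/
def wPoles {N : ℕ} (a : Weyl N) (t₁ : ℕ) (x₁ : ℤ) : Set ℤ :=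
  Set.Icc (x₁ - t₁) x₁ ∩ Set.range a.1

/-- A pair of circles in the complex plane, given by centers and radii. -/
structure Circles where
  c₁ : ℂ
  r₁ : ℝ
  c₂ : ℂ
  r₂ : ℝ

/-- The two circles form an admissible `w` contour: the first one lies, with its interior, to the
left of the `z` line and the second one to the right of it, no circle passes through an integer
(where the integrand may be an indeterminate `0 / 0`), and together they encircle all the `w`
poles. A circle of radius `0` does not contribute to the integral, so that a single circle is
covered as well, when all the poles are on one side of the line. -/
structure Circles.Admissible (γ : Circles) {N : ℕ} (a : Weyl N)
    (t₁ : ℕ) (x₁ : ℤ) (t₂ : ℕ) (x₂ : ℤ) : Prop where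
  nonneg₁ : 0 ≤ γ.r₁
  nonneg₂ : 0 ≤ γ.r₂
  left : ∀ w ∈ Metric.closedBall γ.c₁ γ.r₁, w.re < (x₂ : ℝ) - t₂ + 1 / 2
  right : ∀ w ∈ Metric.closedBall γ.c₂ γ.r₂, (x₂ : ℝ) - t₂ + 1 / 2 < w.re
  avoids₁ : ∀ n : ℤ, (n : ℂ) ∉ Metric.sphere γ.c₁ γ.r₁
  avoids₂ : ∀ n : ℤ, (n : ℂ) ∉ Metric.sphere γ.c₂ γ.r₂
  encircles : ∀ s ∈ wPoles a t₁ x₁,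
    (s : ℂ) ∈ Metric.ball γ.c₁ γ.r₁ ∨ (s : ℂ) ∈ Metric.ball γ.c₂ γ.r₂

/-- The counter-clockwise contour integral over the union of the two circles. -/
def Circles.integral (γ : Circles) (f : ℂ → ℂ) : ℂ :=
  (∮ w in C(γ.c₁, γ.r₁), f w) + ∮ w in C(γ.c₂, γ.r₂), f w

/-- The double contour integral converges: for every `z` on the vertical line the integrand is
integrable in `w` over the circles, and the resulting function of `z` is integrable over
the line. -/
def Converges {N : ℕ} (β : ℝ) (a : Weyl N) (γ : Circles)
    (t₁ : ℕ) (x₁ : ℤ) (t₂ : ℕ) (x₂ : ℤ) : Prop :=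
  (∀ u : ℝ,
    CircleIntegrable (integrand β a t₁ x₁ t₂ x₂ (linePoint t₂ x₂ u)) γ.c₁ γ.r₁ ∧
    CircleIntegrable (integrand β a t₁ x₁ t₂ x₂ (linePoint t₂ x₂ u)) γ.c₂ γ.r₂) ∧
  Integrable fun u : ℝ =>
    γ.integral (integrand β a t₁ x₁ t₂ x₂ (linePoint t₂ x₂ u))

/-- The correlation kernel; `dz = i du` on the vertical line. -/
def kernel {N : ℕ} (β : ℝ) (a : Weyl N) (γ : Circles)
    (t₁ : ℕ) (x₁ : ℤ) (t₂ : ℕ) (x₂ : ℤ) : ℂ :=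
  (if x₂ ≤ x₁ ∧ t₂ < t₁ then
    (-1 : ℂ) ^ (x₁ - x₂ + 1) * ((t₁ - t₂).choose (x₁ - x₂).toNat : ℂ) else 0) +
  (t₁.factorial : ℂ) / ((t₂ - 1).factorial : ℂ) * (1 / (2 * Real.pi * Complex.I) ^ 2) *
    ∫ u : ℝ,
      γ.integral (integrand β a t₁ x₁ t₂ x₂ (linePoint t₂ x₂ u)) * Complex.I

end

end NoncollidingBernoulli

open MeasureTheory

namespace NoncollidingBernoulli

noncomputable section

/-! The walk is the Doob transform, by the Vandermonde product, of independent Bernoulli walks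
killed at collision. Averaging `det (B j (x i))` over independent jumps averages each `B j`
separately (`det_avg`), and a jump that leaves the chamber makes two rows equal. So the expectation
of a product of weights over times and sites is an N × N determinant of one-particle functions run
backwards in time (`sum_transition_mul_det`, `IsWalk.integral_prod_eq`).

The terminal datum is the Vandermonde product, which has to be a determinant too. Take polynomials
`q t j` of degree below N with `avg β (q (t + 1) j) = q t j` and `q 0 j (a i) = δ`; by harmonicity
`det (q t j (x i))` is V(x)/V(a) at every time (`det_mul_vdm_eq`). If the marked sites have weight 1
+ l, a Duhamel expansion and Sylvester's identity turn the N × N determinant into the k × k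
determinant of 1 + l `preKernel` (`det_backward_eq`). Its top coefficient in l is the occupation
probability (`IsWalk.isDeterminantal_preKernel`).

The polynomials come from inverting `avg`, which is (1 - β)(1 + S/c) with S the unit shift and c =
(1 - β)/β. Formally (1 + S/c)^(-(n+1)) is the series of (-1)^k (k+1)_n / n! c^(-k) S^k. Its
Mellin–Barnes form is a vertical line integral against 1/sin, which makes sense for every c > 0 and
is `inverseAvg`; moving the line by one unit picks up one residue, and this yields the recursion.

In the double integral the w residues sit at the entries of `a` in the window [x₁ - t₁, x₁]. They
produce the binomial weights and the Lagrange polynomials at `a`, while the z line produces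
`inverseAvg`. The resulting kernel is a conjugate of `preKernel` (`walkKernel_eq_kernel`), so it has
the same minors. -/

/-! ### Bernoulli averaging and the Vandermonde determinant. -/

/-- The averaging operator of a single Bernoulli step. -/
def avg (β : ℂ) (f : ℤ → ℂ) (x : ℤ) : ℂ := (1 - β) * f x + β * f (x + 1)

/-- The `n`-step transition weights of a single Bernoulli walk. -/
def bernoulliWeight (β : ℂ) : ℕ → ℤ → ℂ
  | 0, d => if d = 0 then 1 else 0
  | n + 1, d => (1 - β) * bernoulliWeight β n d + β * bernoulliWeight β n (d - 1)

/-- The increment encoded by a Boolean. -/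
def jump (b : Bool) : ℤ := if b then 1 else 0

/-- The probability of the increment encoded by a Boolean. -/
def jumpWeight (β : ℂ) (b : Bool) : ℂ := if b then β else 1 - β

lemma avg_eq_sum (β : ℂ) (f : ℤ → ℂ) (x : ℤ) :
    avg β f x = ∑ b : Bool, jumpWeight β b * f (x + jump b) := by
  simp [avg, jumpWeight, jump, add_comm]

lemma avg_bernoulliWeight (β : ℂ) (n : ℕ) (y x : ℤ) :
    avg β (fun x => bernoulliWeight β n (y - x)) x = bernoulliWeight β (n + 1) (y - x) := by
  simp only [avg, bernoulliWeight]
  congr 3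
  ring

/-- Row i is a combination of two rows, one for each jump of particle i; multilinearity in the rows
gives the sum over all jump vectors. -/
lemma det_avg {N : ℕ} (β : ℂ) (B : Fin N → ℤ → ℂ) (x : Fin N → ℤ) :
    Matrix.det (Matrix.of fun i j => avg β (B j) (x i)) =
      ∑ ε : Fin N → Bool, (∏ i, jumpWeight β (ε i)) *
        Matrix.det (Matrix.of fun i j => B j (x i + jump (ε i))) := by
  have h1 : (Matrix.of fun i j => avg β (B j) (x i)) =
      fun i => ∑ b : Bool, jumpWeight β b • (fun j => B j (x i + jump b)) := by
    ext i j
    simp only [Matrix.of_apply, avg_eq_sum, Finset.sum_apply, Pi.smul_apply, smul_eq_mul]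
  rw [h1]
  have h2 := (Matrix.detRowAlternating (n := Fin N) (R := ℂ)).toMultilinearMap.map_sum
    (fun (i : Fin N) (b : Bool) => jumpWeight β b • (fun j => B j (x i + jump b)))
  refine Eq.trans h2 (Finset.sum_congr rfl fun ε _ => ?_)
  exact (Matrix.detRowAlternating (n := Fin N) (R := ℂ)).toMultilinearMap.map_smul_univ
    (fun i => jumpWeight β (ε i)) (fun i j => B j (x i + jump (ε i)))

/-- The Vandermonde determinant of an integer vector. -/
def vdm {N : ℕ} (x : Fin N → ℤ) : ℂ := (Matrix.vandermonde fun i => (x i : ℂ)).det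

lemma vdm_eq_vandermonde {N : ℕ} (x : Weyl N) : vdm x.1 = (vandermonde x : ℂ) := by
  rw [vdm, Matrix.det_vandermonde, vandermonde]
  push_cast
  apply Finset.prod_comm'
  simp

lemma vandermonde_pos {N : ℕ} (x : Weyl N) : 0 < vandermonde x := by
  refine Finset.prod_pos fun i _ => Finset.prod_pos fun j hj => ?_
  have := x.2 (Finset.mem_Iio.1 hj)
  have : (x.1 j : ℝ) < x.1 i := by exact_mod_cast this
  linarith

lemma vdm_ne_zero {N : ℕ} (x : Weyl N) : vdm x.1 ≠ 0 := by
  rw [vdm_eq_vandermonde]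
  exact_mod_cast (vandermonde_pos x).ne'

open Polynomial in
/-- The Vandermonde determinant is harmonic for independent Bernoulli walks. -/
lemma sum_jumpWeight_mul_vdm {N : ℕ} (β : ℂ) (x : Fin N → ℤ) :
    ∑ ε : Fin N → Bool, (∏ i, jumpWeight β (ε i)) * vdm (fun i => x i + jump (ε i)) = vdm x := by
  have h := det_avg β (fun (j : Fin N) n => (n : ℂ) ^ (j : ℕ)) x
  have h1 : ∀ ε : Fin N → Bool, vdm (fun i => x i + jump (ε i)) =
      Matrix.det (Matrix.of fun i (j : Fin N) => ((x i + jump (ε i) : ℤ) : ℂ) ^ (j : ℕ)) :=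
    fun ε => rfl
  simp only [h1]
  rw [← h, vdm]
  have hlt : ∀ j : ℕ, ((X + 1 : ℂ[X]) ^ j - X ^ j).degree < (X ^ j : ℂ[X]).degree := by
    intro j
    have hm : ((X + 1 : ℂ[X]) ^ j).Monic := (monic_X_add_C (1 : ℂ)).pow j
    have hd : ((X + 1 : ℂ[X]) ^ j).degree = (X ^ j : ℂ[X]).degree := by
      have : (X + 1 : ℂ[X]).degree = 1 := degree_X_add_C (1 : ℂ)
      simp [degree_pow, this]
    rw [← hd]
    exact degree_sub_lt_left hd hm.ne_zero (by rw [hm.leadingCoeff, (monic_X_pow j).leadingCoeff])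
  have hltC : ∀ j : ℕ, (C β * ((X + 1 : ℂ[X]) ^ j - X ^ j)).degree < (X ^ j : ℂ[X]).degree :=
    fun j => by rw [← smul_eq_C_mul]; exact lt_of_le_of_lt (degree_smul_le _ _) (hlt j)
  -- The average of the monomial of degree j is again monic of degree j, and monic polynomials of
  -- degrees 0, …, N - 1 give the Vandermonde determinant.
  rw [Matrix.det_eval_matrixOfPolynomials_eq_det_vandermonde _
    (fun j : Fin N => X ^ (j : ℕ) + C β * ((X + 1) ^ (j : ℕ) - X ^ (j : ℕ)))]
  · congr 1
    ext i j
    simp [avg]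
    ring
  · intro j
    rw [natDegree_add_eq_left_of_degree_lt (hltC j), natDegree_X_pow]
  · intro j
    exact (monic_X_pow (j : ℕ)).add_of_left (hltC j)

/-- Functions given by polynomials of degree less than `N` have a determinant proportional to the
Vandermonde determinant. -/
lemma exists_det_eq_mul_vdm {N : ℕ} (q : Fin N → ℤ → ℂ)
    (hq : ∀ j, ∃ b : Fin N → ℂ, ∀ n : ℤ, q j n = ∑ k : Fin N, b k * (n : ℂ) ^ (k : ℕ)) :
    ∃ κ : ℂ, ∀ x : Fin N → ℤ, Matrix.det (Matrix.of fun i j => q j (x i)) = κ * vdm x := by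
  choose b hb using hq
  refine ⟨Matrix.det (Matrix.of fun k j => b j k), fun x => ?_⟩
  rw [vdm, mul_comm, ← Matrix.det_mul]
  congr 1
  ext i j
  simp [Matrix.mul_apply, hb, Matrix.vandermonde_apply, mul_comm]

/-- At each time the determinant is a constant multiple of `vdm x`. Averaging lowers the time by one
and fixes `vdm`, so the constant does not depend on time; the values of `q 0` at `a` determine it.
-/
lemma det_mul_vdm_eq {N : ℕ} (β : ℂ) (a : Fin N → ℤ) (q : ℕ → Fin N → ℤ → ℂ)
    (hq : ∀ t j, ∃ b : Fin N → ℂ, ∀ n : ℤ, q t j n = ∑ k : Fin N, b k * (n : ℂ) ^ (k : ℕ))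
    (hstep : ∀ t j x, avg β (q (t + 1) j) x = q t j x)
    (h0 : ∀ i j, q 0 j (a i) = if i = j then 1 else 0) (t : ℕ) (x : Fin N → ℤ) :
    Matrix.det (Matrix.of fun i j => q t j (x i)) * vdm a = vdm x := by
  induction t generalizing x with
  | zero =>
    obtain ⟨κ, hκ⟩ := exists_det_eq_mul_vdm (q 0) (hq 0)
    have h1 : Matrix.det (Matrix.of fun i j => q 0 j (a i)) = 1 := by
      rw [← Matrix.det_one (n := Fin N)]
      congr 1
      ext i j
      simp [h0, Matrix.one_apply]
    rw [hκ, mul_right_comm, ← hκ, h1, one_mul]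
  | succ t ih =>
    obtain ⟨κ, hκ⟩ := exists_det_eq_mul_vdm (q (t + 1)) (hq (t + 1))
    have h1 : Matrix.det (Matrix.of fun i j => q t j (x i)) = κ * vdm x := by
      have := det_avg β (q (t + 1)) x
      simp only [hstep] at this
      rw [this, ← sum_jumpWeight_mul_vdm β x, Finset.mul_sum]
      refine Finset.sum_congr rfl fun ε _ => ?_
      rw [hκ (fun i => x i + jump (ε i))]
      ring
    rw [hκ, ← h1, ih]

/-! ### Weighted backward recursion and its Fredholm determinant. -/

/-- The multiplicative weight of the site `n` at time `s`. -/
def siteWeight {k : ℕ} (t : Fin k → ℕ) (y : Fin k → ℤ) (l : ℂ) (s : ℕ) (n : ℤ) : ℂ :=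
  1 + ∑ i, if t i = s ∧ y i = n then l else 0

/-- The correlation kernel before conjugation, as a function of two space-time points. -/
def preKernel {N : ℕ} (β : ℂ) (a : Fin N → ℤ) (q : ℕ → Fin N → ℤ → ℂ)
    (t₁ : ℕ) (x₁ : ℤ) (t₂ : ℕ) (x₂ : ℤ) : ℂ :=
  (∑ j, bernoulliWeight β t₁ (x₁ - a j) * q t₂ j x₂) -
    if t₂ < t₁ then bernoulliWeight β (t₁ - t₂) (x₁ - x₂) else 0

lemma avg_add (β : ℂ) (f g : ℤ → ℂ) (x : ℤ) :
    avg β (fun n => f n + g n) x = avg β f x + avg β g x := by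
  simp only [avg]; ring

lemma avg_sum {ι : Type*} (s : Finset ι) (β : ℂ) (f : ι → ℤ → ℂ) (x : ℤ) :
    avg β (fun n => ∑ i ∈ s, f i n) x = ∑ i ∈ s, avg β (f i) x := by
  simp only [avg, Finset.mul_sum, Finset.sum_add_distrib]

lemma avg_mul_const (β : ℂ) (f : ℤ → ℂ) (d : ℂ) (x : ℤ) :
    avg β (fun n => f n * d) x = avg β f x * d := by
  simp only [avg]; ring

section Fredholm

variable {N k T : ℕ} {β l : ℂ} {a : Fin N → ℤ} {t : Fin k → ℕ} {y : Fin k → ℤ}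
  {q R : ℕ → Fin N → ℤ → ℂ}

/-- The excess of the weight over 1 is a sum of point masses at the marked sites, and averaging a
point mass gives a one-step Bernoulli weight. This is the source term of the Duhamel expansion. -/
lemma avg_siteWeight_sub_one (s : ℕ) (f : ℤ → ℂ) (x : ℤ) :
    avg β (fun n => siteWeight t y l s n * f n) x = avg β f x +
      ∑ i, if t i = s then bernoulliWeight β 1 (y i - x) * (l * f (y i)) else 0 := by
  have h1 : ∀ n, siteWeight t y l s n * f n =
      f n + ∑ i, (if t i = s then (if y i - n = 0 then (1 : ℂ) else 0) * (l * f (y i)) else 0) := by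
    intro n
    rw [siteWeight, add_mul, one_mul, Finset.sum_mul]
    congr 1
    refine Finset.sum_congr rfl fun i _ => ?_
    by_cases h : t i = s <;> by_cases h' : y i = n <;> simp [h, h', sub_eq_zero]
  simp only [h1, avg_add, avg_sum]
  congr 1
  refine Finset.sum_congr rfl fun i _ => ?_
  by_cases h : t i = s
  · simp only [h, if_true]
    rw [avg_mul_const]
    congr 1
    exact avg_bernoulliWeight β 0 (y i) x
  · simp [h, avg]

/-- Duhamel expansion of the backward recursion with weighted sites. -/
lemma backward_eq (hstep : ∀ t j x, avg β (q (t + 1) j) x = q t j x)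
    (hRT : R T = q T)
    (hR : ∀ s < T, ∀ j x, R s j x = avg β (fun n => siteWeight t y l (s + 1) n * R (s + 1) j n) x)
    (hT : ∀ i, t i ≤ T) (d : ℕ) (s : ℕ) (hs : s + d = T) (j : Fin N) (x : ℤ) :
    R s j x = q s j x + ∑ i, if s < t i then
      bernoulliWeight β (t i - s) (y i - x) * (l * R (t i) j (y i)) else 0 := by
  induction d generalizing s x with
  | zero =>
    obtain rfl : s = T := by omega
    have : ∀ i, ¬ s < t i := fun i => not_lt.2 (hT i)
    simp [this, hRT]
  | succ d ih =>
    rw [hR s (by omega), avg_siteWeight_sub_one]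
    have h1 : (R (s + 1) j) = fun x => q (s + 1) j x + ∑ i, if s + 1 < t i then
      bernoulliWeight β (t i - (s + 1)) (y i - x) * (l * R (t i) j (y i)) else 0 := by
      ext x; exact ih (s + 1) (by omega) x
    have h2 : avg β (R (s + 1) j) x = q s j x + ∑ i, if s + 1 < t i then
      bernoulliWeight β (t i - s) (y i - x) * (l * R (t i) j (y i)) else 0 := by
      rw [h1, avg_add, hstep, avg_sum]
      congr 1
      refine Finset.sum_congr rfl fun i _ => ?_
      by_cases h : s + 1 < t i
      · simp only [h, if_true]
        rw [avg_mul_const, avg_bernoulliWeight]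
        congr 3; omega
      · simp [h, avg]
    rw [h2, add_assoc, ← Finset.sum_add_distrib]
    congr 1
    refine Finset.sum_congr rfl fun i _ => ?_
    rcases lt_trichotomy (s + 1) (t i) with h | h | h
    · simp [h, h.ne', (by omega : s < t i)]
    · simp only [← h, lt_irrefl, if_false, if_true, zero_add]
      simp
    · rw [if_neg (by omega), if_neg (by omega), if_neg (by omega), add_zero]

/-- Such a matrix only leads strictly forward in time, so `1 - Φ` is block triangular for the
grading by `t`, with identity diagonal blocks. -/
lemma det_one_sub_strict (Φ : Matrix (Fin k) (Fin k) ℂ) (hΦ : ∀ i j, t j ≤ t i → Φ i j = 0) :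
    (1 - Φ).det = 1 := by
  have hb : (1 - Φ).BlockTriangular t := by
    intro i j hij
    have : i ≠ j := by rintro rfl; exact lt_irrefl _ hij
    simp [hΦ i j hij.le, Matrix.one_apply_ne this]
  rw [hb.det]
  refine Finset.prod_eq_one fun s _ => ?_
  rw [← Matrix.det_one (n := { i // t i = s })]
  congr 1
  ext i j
  simp [Matrix.toSquareBlock, Matrix.toSquareBlockProp, hΦ i j (by rw [i.2, j.2]),
    Matrix.one_apply, Subtype.ext_iff]

/-- The `N × N` determinant of the backward recursion is a Fredholm determinant of `preKernel`. -/
lemma det_backward_eq (hstep : ∀ t j x, avg β (q (t + 1) j) x = q t j x)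
    (h0 : ∀ i j, q 0 j (a i) = if i = j then 1 else 0)
    (hRT : R T = q T)
    (hR : ∀ s < T, ∀ j x, R s j x = avg β (fun n => siteWeight t y l (s + 1) n * R (s + 1) j n) x)
    (hT : ∀ i, t i ≤ T) :
    Matrix.det (Matrix.of fun i j => siteWeight t y l 0 (a i) * R 0 j (a i)) =
      Matrix.det (1 + l • Matrix.of fun i j =>
        preKernel β a q (t i) (y i) (t j) (y j)) := by
  set Ψ : Matrix (Fin N) (Fin k) ℂ := Matrix.of fun i m => bernoulliWeight β (t m) (y m - a i)
  set S : Matrix (Fin k) (Fin N) ℂ := Matrix.of fun m j => R (t m) j (y m)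
  set Q : Matrix (Fin k) (Fin N) ℂ := Matrix.of fun m j => q (t m) j (y m)
  set Φ : Matrix (Fin k) (Fin k) ℂ := Matrix.of fun m m' =>
    if t m < t m' then bernoulliWeight β (t m' - t m) (y m' - y m) else 0
  have hB := backward_eq hstep hRT hR hT
  have hS : S = Q + (l • Φ) * S := by
    ext m j
    have := hB (T - t m) (t m) (by have := hT m; omega) j (y m)
    simp only [S, Q, Φ, Matrix.add_apply, Matrix.mul_apply, Matrix.of_apply, Matrix.smul_apply,
      smul_eq_mul]
    rw [this]
    congr 1
    refine Finset.sum_congr rfl fun i _ => ?_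
    split_ifs
    · ring
    · ring
  have hM : (Matrix.of fun i j => siteWeight t y l 0 (a i) * R 0 j (a i)) = 1 + Ψ * (l • S) := by
    ext i j
    have := hB T 0 (by omega) j (a i)
    simp only [Ψ, S, Matrix.add_apply, Matrix.mul_apply, Matrix.of_apply, Matrix.smul_apply,
      smul_eq_mul, siteWeight, add_mul, one_mul, Finset.sum_mul]
    conv_lhs => enter [1]; rw [this]
    rw [h0, add_assoc, Matrix.one_apply]
    congr 1
    rw [← Finset.sum_add_distrib]
    refine Finset.sum_congr rfl fun m _ => ?_
    -- Sites marked at time 0 are not seen by `R 0`; their contribution comes from the factor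
    -- `siteWeight` at time 0, and the zero-step weight is the matching delta.
    by_cases h : t m = 0
    · by_cases h' : y m = a i
      · simp [h, h', bernoulliWeight]
      · simp [h, h', bernoulliWeight, sub_eq_zero]
    · simp [h, Nat.pos_of_ne_zero h]
  rw [hM, Matrix.det_one_add_mul_comm]
  have hdet : (1 - l • Φ).det = 1 := by
    apply det_one_sub_strict (t := t)
    intro i j hij
    simp [Φ, not_lt.2 hij]
  -- Multiplying by `1 - l • Φ`, of determinant 1, replaces the implicit `S` by `Q`. The transpose
  -- is needed because the Bernoulli weight belongs to the first space-time argument of `preKernel`.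
  rw [← one_mul (Matrix.det (1 + (l • S) * Ψ)), ← hdet, ← Matrix.det_mul, ← Matrix.det_transpose]
  congr 1
  have : (1 - l • Φ) * (1 + (l • S) * Ψ) = 1 - l • Φ + l • (Q * Ψ) := by
    have h1 : (1 - l • Φ) * S = Q := by
      rw [Matrix.sub_mul, Matrix.one_mul]; nth_rewrite 1 [hS]; simp
    rw [mul_add, mul_one, ← Matrix.mul_assoc, Matrix.mul_smul, h1, Matrix.smul_mul]
  rw [this]
  ext i j
  simp only [Matrix.transpose_apply, Matrix.add_apply, Matrix.sub_apply, Matrix.smul_apply,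
    Matrix.mul_apply, Matrix.of_apply, Q, Ψ, Φ, preKernel, smul_eq_mul, Matrix.one_apply, eq_comm]
  have : ∑ x, q (t j) x (y j) * bernoulliWeight β (t i) (y i - a x) =
    ∑ x, bernoulliWeight β (t i) (y i - a x) * q (t j) x (y j) :=
    Finset.sum_congr rfl fun x _ => mul_comm _ _
  rw [this]
  ring

end Fredholm

/-! ### One step of the walk as a Doob transform. -/

/-- The Boolean vector of the increments of the coordinates. -/
def increments {N : ℕ} (x x' : Weyl N) (i : Fin N) : Bool := decide (x'.1 i - x.1 i = 1)

lemma finite_successors {N : ℕ} (x : Weyl N) :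
    {x' : Weyl N | ∀ i, x'.1 i - x.1 i = 0 ∨ x'.1 i - x.1 i = 1}.Finite := by
  refine Set.Finite.of_injOn (f := increments x) (t := Set.univ) (fun _ _ => Set.mem_univ _) ?_
    Set.finite_univ
  intro y hy z hz h
  refine Subtype.ext (funext fun i => ?_)
  have h1 := congrFun h i
  simp only [increments, decide_eq_decide] at h1
  have h2 := hy i
  have h3 := hz i
  omega

/-- The states that can be reached from `x` in one step. -/
def successors {N : ℕ} (x : Weyl N) : Finset (Weyl N) := (finite_successors x).toFinset

lemma mem_successors {N : ℕ} {x x' : Weyl N} :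
    x' ∈ successors x ↔ ∀ i, x'.1 i - x.1 i = 0 ∨ x'.1 i - x.1 i = 1 := by
  simp [successors]

lemma eq_add_jump_increments {N : ℕ} {x x' : Weyl N} (h : x' ∈ successors x) (i : Fin N) :
    x'.1 i = x.1 i + jump (increments x x' i) := by
  have := mem_successors.1 h i
  by_cases h1 : x'.1 i - x.1 i = 1
  · simp [increments, jump, h1]; omega
  · simp [increments, jump, h1]; omega

lemma zpow_sum_eq_prod {ι : Type*} (s : Finset ι) {b : ℝ} (hb : b ≠ 0) (d : ι → ℤ) :
    b ^ (∑ i ∈ s, d i) = ∏ i ∈ s, b ^ d i := by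
  classical
  induction s using Finset.induction_on with
  | empty => simp
  | insert i s hi ih => rw [Finset.sum_insert hi, Finset.prod_insert hi, zpow_add₀ hb, ih]

lemma transition_eq {N : ℕ} {β : ℝ} (hβ₀ : 0 < β) (hβ₁ : β < 1) {x x' : Weyl N}
    (h : x' ∈ successors x) :
    (transition β x x' : ℂ) =
      vdm x'.1 / vdm x.1 * ∏ i, jumpWeight β (increments x x' i) := by
  have h1 : total x' - total x = ∑ i, jump (increments x x' i) := by
    rw [total, total, ← Finset.sum_sub_distrib]
    refine Finset.sum_congr rfl fun i _ => ?_
    rw [eq_add_jump_increments h i]; ring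
  have h2 : (N : ℤ) - total x' + total x = ∑ i, (1 - jump (increments x x' i)) := by
    rw [Finset.sum_sub_distrib, ← h1]; simp; ring
  rw [transition, if_pos (mem_successors.1 h), h1, h2, zpow_sum_eq_prod _ hβ₀.ne',
    zpow_sum_eq_prod _ (sub_pos.2 hβ₁).ne', mul_assoc, ← Finset.prod_mul_distrib,
    vdm_eq_vandermonde, vdm_eq_vandermonde]
  push_cast
  congr 1
  refine Finset.prod_congr rfl fun i _ => ?_
  cases increments x x' i <;> simp [jump, jumpWeight]

/-- The Karlin–McGregor mechanism: the Vandermonde factor of the new state cancels, and the sum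
extends to all jump vectors because the added ones contribute nothing. -/
lemma sum_transition_mul_det {N : ℕ} {β : ℝ} (hβ₀ : 0 < β) (hβ₁ : β < 1) (x : Weyl N)
    (B : Fin N → ℤ → ℂ) :
    ∑ x' ∈ successors x, (transition β x x' : ℂ) *
        (Matrix.det (Matrix.of fun i j => B j (x'.1 i)) / vdm x'.1) =
      Matrix.det (Matrix.of fun i j => avg β (B j) (x.1 i)) / vdm x.1 := by
  rw [det_avg, Finset.sum_div]
  refine Finset.sum_of_injOn (increments x) ?_ (fun _ _ => by simp) ?_ ?_
  · intro y hy z hz h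
    refine Subtype.ext (funext fun i => ?_)
    rw [eq_add_jump_increments hy i, eq_add_jump_increments hz i, h]
  · intro ε _ hε
    have hns : ¬ StrictMono fun i => x.1 i + jump (ε i) := by
      intro hs
      refine hε ⟨⟨_, hs⟩, ?_, ?_⟩
      · rw [Finset.mem_coe, mem_successors]
        intro i
        cases h : ε i <;> simp [jump, h]
      · ext i
        cases h : ε i <;> simp [increments, jump, h]
    -- Jumps are 0 or 1 and the old coordinates are strictly increasing integers, so order can only
    -- fail through a coincidence of two coordinates, which makes two rows equal.
    simp only [StrictMono, not_forall, not_lt] at hns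
    obtain ⟨i, j, hij, hle⟩ := hns
    have hx := x.2 hij
    have heq : x.1 i + jump (ε i) = x.1 j + jump (ε j) := by
      have h1 : jump (ε i) ≤ 1 := by cases ε i <;> simp [jump]
      have h2 : 0 ≤ jump (ε j) := by cases ε j <;> simp [jump]
      omega
    rw [Matrix.det_zero_of_row_eq hij.ne (by ext m; simp [heq])]
    simp
  · intro x' hx'
    rw [transition_eq hβ₀ hβ₁ hx']
    have := vdm_ne_zero x'
    have h1 : (Matrix.of fun i j => B j (x'.1 i)) =
        Matrix.of fun i j => B j (x.1 i + jump (increments x x' i)) := by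
      ext i j
      simp only [Matrix.of_apply]
      rw [← eq_add_jump_increments hx' i]
    rw [h1]
    field_simp

/-! ### Expectations of products along the Markov chain. -/

section Markov

variable {N : ℕ} {β : ℝ} {a : Weyl N} {Ω : Type*} [MeasurableSpace Ω] {P : Measure Ω}
  {X : ℕ → Ω → Weyl N}

lemma IsWalk.measurableSet_eq (hX : IsWalk β a P X) (s : ℕ) (x : Weyl N) :
    MeasurableSet {ω | X s ω = x} := hX.measurable s (measurableSet_singleton x)

lemma IsWalk.measurableSet_history (hX : IsWalk β a P X) (s : ℕ) (x : ℕ → Weyl N) :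
    MeasurableSet {ω | ∀ r ≤ s, X r ω = x r} := by
  have : {ω | ∀ r ≤ s, X r ω = x r} = ⋂ r ∈ Set.Iic s, {ω | X r ω = x r} := by
    ext; simp
  rw [this]
  exact MeasurableSet.biInter (Set.to_countable _) fun r _ => hX.measurableSet_eq r _

variable [IsProbabilityMeasure P]

lemma IsWalk.integrable_prod (hX : IsWalk β a P X) (g : ℕ → Weyl N → ℂ) {C : ℝ}
    (hg : ∀ s x, ‖g s x‖ ≤ C) (I : Finset ℕ) :
    Integrable (fun ω => ∏ r ∈ I, g r (X r ω)) P := by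
  refine Integrable.of_bound (C := C ^ I.card) ?_ (Filter.Eventually.of_forall fun ω => ?_)
  · refine (Finset.measurable_fun_prod I fun r _ => ?_).aestronglyMeasurable
    exact (Measurable.of_discrete (f := g r)).comp (hX.measurable r)
  · rw [norm_prod]
    calc ∏ r ∈ I, ‖g r (X r ω)‖ ≤ ∏ _r ∈ I, C :=
          Finset.prod_le_prod (fun _ _ => norm_nonneg _) fun r _ => hg r _
      _ = C ^ I.card := by simp

/-- Each state outside `successors` has transition weight zero, and there are only countably many
states, so the exceptional event is null. -/
lemma IsWalk.history_ae_eq (hX : IsWalk β a P X) (s : ℕ) (x : ℕ → Weyl N) :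
    {ω | ∀ r ≤ s, X r ω = x r} =ᵐ[P]
      ⋃ x' ∈ successors (x s), {ω | (∀ r ≤ s, X r ω = x r) ∧ X (s + 1) ω = x'} := by
  have h : ∀ᵐ ω ∂P, ∀ x' : Weyl N, x' ∉ successors (x s) →
      ¬ ((∀ r ≤ s, X r ω = x r) ∧ X (s + 1) ω = x') := by
    rw [ae_all_iff]
    intro x'
    by_cases hx' : x' ∈ successors (x s)
    · simp [hx']
    · have h1 := hX.markov s x x'
      rw [transition, if_neg (by rwa [mem_successors] at hx'), mul_zero,
        measureReal_eq_zero_iff] at h1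
      have h2 := measure_eq_zero_iff_ae_notMem.1 h1
      filter_upwards [h2] with ω hω _
      exact hω
  filter_upwards [h] with ω hω
  apply propext
  change (∀ r ≤ s, X r ω = x r) ↔
    ω ∈ ⋃ x' ∈ successors (x s), {ω | (∀ r ≤ s, X r ω = x r) ∧ X (s + 1) ω = x'}
  simp only [Set.mem_iUnion, Set.mem_ofPred_eq]
  constructor
  · intro hp
    refine ⟨X (s + 1) ω, ?_, hp, rfl⟩
    by_contra hc
    exact hω _ hc ⟨hp, rfl⟩
  · rintro ⟨_, _, hp, _⟩
    exact hp

/-- The function `w s` is the conditional expectation of the remaining product given the state at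
time s. Splitting a history by the next state and inducting down from T avoids conditioning on null
events. -/
lemma IsWalk.setIntegral_history (hX : IsWalk β a P X) (g w : ℕ → Weyl N → ℂ) {C : ℝ}
    (hg : ∀ s x, ‖g s x‖ ≤ C) {T : ℕ} (hwT : ∀ x, w T x = 1)
    (hw : ∀ s < T, ∀ x, w s x = ∑ x' ∈ successors x,
      (transition β x x' : ℂ) * (g (s + 1) x' * w (s + 1) x'))
    (d s : ℕ) (hs : s + d = T) (x : ℕ → Weyl N) :
    ∫ ω in {ω | ∀ r ≤ s, X r ω = x r}, ∏ r ∈ Finset.Ioc s T, g r (X r ω) ∂P =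
      (P.real {ω | ∀ r ≤ s, X r ω = x r} : ℂ) * w s (x s) := by
  induction d generalizing s x with
  | zero =>
    obtain rfl : s = T := by omega
    simp [hwT]
  | succ d ih =>
    have hms : ∀ x', MeasurableSet {ω | (∀ r ≤ s, X r ω = x r) ∧ X (s + 1) ω = x'} := fun x' =>
      (hX.measurableSet_history s x).inter (hX.measurableSet_eq (s + 1) x')
    rw [setIntegral_congr_set (hX.history_ae_eq s x), integral_biUnion_finset, hw s (by omega),
      Finset.mul_sum]
    · refine Finset.sum_congr rfl fun x' _ => ?_
      have h1 : {ω | (∀ r ≤ s, X r ω = x r) ∧ X (s + 1) ω = x'} =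
          {ω | ∀ r ≤ s + 1, X r ω = Function.update x (s + 1) x' r} := by
        ext ω
        simp only [Set.mem_ofPred_eq]
        constructor
        · rintro ⟨h, h'⟩ r hr
          rcases Nat.lt_or_eq_of_le hr with hr | rfl
          · rw [Function.update_of_ne hr.ne]; exact h r (by omega)
          · simpa using h'
        · intro h
          refine ⟨fun r hr => ?_, by simpa using h (s + 1) le_rfl⟩
          rw [h r (by omega), Function.update_of_ne (by omega)]
      have h2 : ∀ ω ∈ {ω | (∀ r ≤ s, X r ω = x r) ∧ X (s + 1) ω = x'},
          ∏ r ∈ Finset.Ioc s T, g r (X r ω) =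
            g (s + 1) x' * ∏ r ∈ Finset.Ioc (s + 1) T, g r (X r ω) := by
        rintro ω ⟨_, h⟩
        have hI : Finset.Ioc s T = Finset.Icc (s + 1) T := by ext; simp
        rw [hI, ← Finset.mul_prod_Ioc_eq_prod_Icc (by omega : s + 1 ≤ T), h]
      rw [setIntegral_congr_fun (hms x') h2, integral_const_mul]
      have h3 := ih (s + 1) (by omega) (Function.update x (s + 1) x')
      rw [← h1] at h3
      rw [h3, hX.markov s x x', Function.update_self]
      push_cast
      ring
    · exact fun x' _ => hms x'
    · intro x' _ x'' _ hne
      rw [Function.onFun, Set.disjoint_left]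
      rintro ω ⟨_, h1⟩ ⟨_, h2⟩
      exact hne (h1.symm.trans h2)
    · exact fun x' _ => (hX.integrable_prod g hg _).integrableOn

lemma IsWalk.integral_prod_eq (hX : IsWalk β a P X) (g w : ℕ → Weyl N → ℂ) {C : ℝ}
    (hg : ∀ s x, ‖g s x‖ ≤ C) {T : ℕ} (hwT : ∀ x, w T x = 1)
    (hw : ∀ s < T, ∀ x, w s x = ∑ x' ∈ successors x,
      (transition β x x' : ℂ) * (g (s + 1) x' * w (s + 1) x')) :
    ∫ ω, ∏ r ∈ Finset.Icc 0 T, g r (X r ω) ∂P = g 0 a * w 0 a := by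
  have h := hX.setIntegral_history g w hg hwT hw T 0 (by omega) (fun _ => a)
  have h1 : ({ω | ∀ r ≤ 0, X r ω = a} : Set Ω) =ᵐ[P] Set.univ := by
    filter_upwards [hX.start] with ω hω
    apply propext
    change (∀ r ≤ 0, X r ω = a) ↔ True
    simp [hω]
  rw [setIntegral_congr_set h1, measureReal_congr h1, setIntegral_univ, probReal_univ] at h
  have h2 : ∀ᵐ ω ∂P, ∏ r ∈ Finset.Icc 0 T, g r (X r ω) =
      g 0 a * ∏ r ∈ Finset.Ioc 0 T, g r (X r ω) := by
    filter_upwards [hX.start] with ω hω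
    rw [← Finset.mul_prod_Ioc_eq_prod_Icc (Nat.zero_le T), hω]
  rw [integral_congr_ae h2, integral_const_mul, h]
  simp

end Markov

/-! ### Occupation probabilities as minors. -/

/-- As the marked points are distinct, at most one of them is at a given site and time, so sum and
product agree. -/
lemma siteWeight_eq_prod {k : ℕ} {t : Fin k → ℕ} {y : Fin k → ℤ}
    (hty : Function.Injective fun i => (t i, y i)) (l : ℂ) (s : ℕ) (n : ℤ) :
    siteWeight t y l s n = ∏ i, if t i = s ∧ y i = n then 1 + l else 1 := by
  by_cases h : ∃ i, t i = s ∧ y i = n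
  · obtain ⟨i, hi⟩ := h
    have hne : ∀ m, m ≠ i → ¬ (t m = s ∧ y m = n) := by
      intro m hm hc
      exact hm (hty (by simp [hc.1, hc.2, hi.1, hi.2]))
    rw [siteWeight, Finset.sum_eq_single i, Finset.prod_eq_single i]
    · simp [hi]
    · intro m _ hm; rw [if_neg (hne m hm)]
    · simp
    · intro m _ hm; rw [if_neg (hne m hm)]
    · simp
  · push Not at h
    have h' : ∀ i, ¬ (t i = s ∧ y i = n) := fun i hi => h i hi.1 hi.2
    simp [siteWeight, h']

open Classical in
lemma prod_siteWeight {N k T : ℕ} {t : Fin k → ℕ} {y : Fin k → ℤ}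
    (hty : Function.Injective fun i => (t i, y i)) (hT : ∀ i, t i ≤ T) (l : ℂ)
    (x : ℕ → Weyl N) :
    ∏ r ∈ Finset.Icc 0 T, ∏ j, siteWeight t y l r ((x r).1 j) =
      ∏ i, if ∃ j, (x (t i)).1 j = y i then 1 + l else 1 := by
  simp only [siteWeight_eq_prod hty]
  rw [Finset.prod_congr rfl fun r _ => Finset.prod_comm, Finset.prod_comm]
  refine Finset.prod_congr rfl fun i _ => ?_
  rw [Finset.prod_eq_single (t i)]
  · by_cases h : ∃ j, (x (t i)).1 j = y i
    · rw [if_pos h]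
      obtain ⟨j, hj⟩ := h
      rw [Finset.prod_eq_single j]
      · simp [hj]
      · intro m _ hm
        rw [if_neg]
        rintro ⟨_, h2⟩
        exact hm ((x (t i)).2.injective (h2.symm.trans hj.symm))
      · simp
    · rw [if_neg h]
      push Not at h
      exact Finset.prod_eq_one fun j _ => by rw [if_neg]; rintro ⟨_, h2⟩; exact h j h2.symm
  · intro r _ hr
    exact Finset.prod_eq_one fun j _ => by rw [if_neg]; rintro ⟨h2, _⟩; exact hr h2.symm
  · intro h
    exact absurd (Finset.mem_Icc.2 ⟨Nat.zero_le _, hT i⟩) h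

section Correlations

variable {N : ℕ} {β : ℝ} {a : Weyl N} {Ω : Type*} [MeasurableSpace Ω] {P : Measure Ω}
  [IsProbabilityMeasure P] {X : ℕ → Ω → Weyl N}

lemma exists_backward (T : ℕ) (β : ℂ) (q : ℕ → Fin N → ℤ → ℂ) (m : ℕ → ℤ → ℂ) :
    ∃ R : ℕ → Fin N → ℤ → ℂ, R T = q T ∧
      ∀ s < T, ∀ j x, R s j x = avg β (fun n => m (s + 1) n * R (s + 1) j n) x := by
  let S : ℕ → Fin N → ℤ → ℂ := fun d => Nat.rec (q T)
    (fun d f j x => avg β (fun n => m (T - d) n * f j n) x) d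
  refine ⟨fun s => S (T - s), by simp [S], fun s hs j x => ?_⟩
  have h1 : T - s = (T - (s + 1)) + 1 := by omega
  have h2 : T - (T - (s + 1)) = s + 1 := by omega
  beta_reduce
  rw [h1]
  change avg β (fun n => m (T - (T - (s + 1))) n * S (T - (s + 1)) j n) x = _
  rw [h2]

open Classical in
/-- The generating function of the occupation events is a Fredholm determinant. -/
lemma IsWalk.integral_prod_occupied (hX : IsWalk β a P X) (hβ₀ : 0 < β) (hβ₁ : β < 1)
    {q : ℕ → Fin N → ℤ → ℂ}
    (hq : ∀ t j, ∃ b : Fin N → ℂ, ∀ n : ℤ, q t j n = ∑ k : Fin N, b k * (n : ℂ) ^ (k : ℕ))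
    (hstep : ∀ t j x, avg β (q (t + 1) j) x = q t j x)
    (h0 : ∀ i j, q 0 j (a.1 i) = if i = j then 1 else 0)
    {k : ℕ} {t : Fin k → ℕ} {y : Fin k → ℤ}
    (hty : Function.Injective fun i => (t i, y i)) (l : ℂ) :
    ∫ ω, ∏ i, (if ∃ j, (X (t i) ω).1 j = y i then 1 + l else 1) ∂P =
      Matrix.det (1 + l • Matrix.of fun i j =>
        preKernel β a.1 q (t i) (y i) (t j) (y j)) := by
  set T := ∑ i, t i
  have hT : ∀ i, t i ≤ T := fun i => Finset.single_le_sum (fun _ _ => Nat.zero_le _)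
    (Finset.mem_univ i)
  obtain ⟨R, hRT, hR⟩ := exists_backward T (β : ℂ) q (siteWeight t y l)
  have hV := vdm_ne_zero a
  rw [← det_backward_eq hstep h0 hRT hR hT]
  simp only [fun ω => (prod_siteWeight hty hT l (fun r => X r ω)).symm]
  have hdet : ∀ s (x : Fin N → ℤ), Matrix.det (Matrix.of fun i j =>
      siteWeight t y l s (x i) * R s j (x i)) =
      (∏ i, siteWeight t y l s (x i)) * Matrix.det (Matrix.of fun i j => R s j (x i)) := fun s x =>
    Matrix.det_mul_column (fun i => siteWeight t y l s (x i)) (Matrix.of fun i j => R s j (x i))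
  rw [hX.integral_prod_eq (fun s x => ∏ i, siteWeight t y l s (x.1 i))
    (fun s x => Matrix.det (Matrix.of fun i j => R s j (x.1 i)) * vdm a.1 / vdm x.1)
    (C := (1 + k * ‖l‖) ^ N) (T := T)]
  · rw [hdet]
    field_simp
  · intro s x
    rw [norm_prod]
    have hb : ∀ n, ‖siteWeight t y l s n‖ ≤ 1 + k * ‖l‖ := by
      intro n
      rw [siteWeight]
      refine (norm_add_le _ _).trans (add_le_add (by simp) ((norm_sum_le _ _).trans ?_))
      have : ∀ i ∈ Finset.univ, ‖if t i = s ∧ y i = n then l else 0‖ ≤ ‖l‖ := by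
        intro i _
        split_ifs <;> simp
      simpa using Finset.sum_le_card_nsmul _ _ _ this
    calc ∏ i, ‖siteWeight t y l s (x.1 i)‖ ≤ ∏ _i : Fin N, (1 + k * ‖l‖) :=
          Finset.prod_le_prod (fun _ _ => norm_nonneg _) fun i _ => hb _
      _ = _ := by simp
  · intro x
    rw [hRT, det_mul_vdm_eq (β : ℂ) a.1 q hq hstep h0, div_self (vdm_ne_zero x)]
  · intro s hs x
    simp only [hR s hs]
    have := sum_transition_mul_det hβ₀ hβ₁ x (fun j n => siteWeight t y l (s + 1) n * R (s + 1) j n)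
    rw [mul_div_right_comm, ← this, Finset.sum_mul]
    refine Finset.sum_congr rfl fun x' _ => ?_
    rw [hdet]
    ring

open Classical in
/-- The occupation probabilities are minors of the kernel. -/
theorem IsWalk.isDeterminantal_preKernel (hX : IsWalk β a P X) (hβ₀ : 0 < β) (hβ₁ : β < 1)
    {q : ℕ → Fin N → ℤ → ℂ}
    (hq : ∀ t j, ∃ b : Fin N → ℂ, ∀ n : ℤ, q t j n = ∑ k : Fin N, b k * (n : ℂ) ^ (k : ℕ))
    (hstep : ∀ t j x, avg β (q (t + 1) j) x = q t j x)
    (h0 : ∀ i j, q 0 j (a.1 i) = if i = j then 1 else 0) :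
    IsDeterminantal P X (preKernel β a.1 q) := by
  intro k t y hty
  set M : Matrix (Fin k) (Fin k) ℂ :=
    Matrix.of fun i j => preKernel β a.1 q (t i) (y i) (t j) (y j)
  let occ : Fin k → Ω → ℂ := fun i ω => if ∃ j, (X (t i) ω).1 j = y i then 1 else 0
  have hms : ∀ i, MeasurableSet {ω | ∃ j, (X (t i) ω).1 j = y i} := fun i =>
    hX.measurable (t i) (MeasurableSet.of_discrete (s := {x : Weyl N | ∃ j, x.1 j = y i}))
  have hocc : ∀ i, Measurable (occ i) := fun i =>
    Measurable.ite (hms i) measurable_const measurable_const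
  have hint : ∀ I : Finset (Fin k), Integrable (fun ω => ∏ i ∈ I, occ i ω) P := by
    intro I
    refine Integrable.of_bound (C := 1)
      (Finset.measurable_fun_prod I fun r _ => hocc r).aestronglyMeasurable
      (Filter.Eventually.of_forall fun ω => ?_)
    rw [norm_prod]
    refine Finset.prod_le_one (fun _ _ => norm_nonneg _) fun i _ => ?_
    simp only [occ]
    split_ifs <;> simp
  -- With μ = 1/l the generating identity becomes E ∏ (μ + occ) = det (μ + M) for μ ≠ 0. Expanding
  -- the product shows that the left side is a polynomial in μ, so continuity allows μ = 0, which is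
  -- the claim.
  let f : ℂ → ℂ := fun μ => ∑ I ∈ (Finset.univ : Finset (Fin k)).powerset,
    μ ^ I.card * ∫ ω, ∏ i ∈ Finset.univ \ I, occ i ω ∂P
  have hf : ∀ μ, f μ = ∫ ω, ∏ i, (μ + occ i ω) ∂P := by
    intro μ
    simp only [Finset.prod_add, Finset.prod_const]
    rw [integral_finsetSum]
    · simp only [integral_const_mul, f]
    · exact fun I _ => (hint _).const_mul _
  have hcf : Continuous f := by fun_prop
  have hcd : Continuous fun μ : ℂ => (μ • (1 : Matrix (Fin k) (Fin k) ℂ) + M).det := by fun_prop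
  have heq : f = fun μ : ℂ => (μ • (1 : Matrix (Fin k) (Fin k) ℂ) + M).det := by
    refine Continuous.ext_on (dense_compl_singleton (0 : ℂ)) hcf hcd fun μ hμ => ?_
    have hμ : μ ≠ 0 := hμ
    have h := hX.integral_prod_occupied hβ₀ hβ₁ hq hstep h0 hty μ⁻¹
    have h1 : μ • (1 : Matrix (Fin k) (Fin k) ℂ) + M = μ • (1 + μ⁻¹ • M) := by
      rw [smul_add, smul_smul, mul_inv_cancel₀ hμ, one_smul]
    rw [hf, h1, Matrix.det_smul, ← h, ← integral_const_mul]
    congr 1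
    ext ω
    rw [← Finset.card_univ, ← Finset.prod_const, ← Finset.prod_mul_distrib]
    refine Finset.prod_congr rfl fun i _ => ?_
    simp only [occ]
    split_ifs <;> field_simp
    simp
  have h := congrFun heq 0
  rw [hf] at h
  simp only [zero_add, zero_smul] at h
  rw [← h]
  have hind : (fun ω => ∏ i, occ i ω) =
      Set.indicator {ω | ∀ i, ∃ j, (X (t i) ω).1 j = y i} (fun _ => (1 : ℂ)) := by
    ext ω
    simp only [occ, Finset.prod_ite_zero, Set.indicator_apply, Set.mem_ofPred_eq,
      Finset.mem_univ, true_implies, Finset.prod_const_one]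
  rw [hind, integral_indicator_const]
  · simp
  · rw [Set.ofPred_forall]
    exact MeasurableSet.iInter hms

end Correlations

/-! ### Vertical line integrals and the residue of 1/sin. -/

/-- Entire functions that grow at most like `exp |Im z|` in every vertical strip. -/
structure Tame (h : ℂ → ℂ) : Prop where
  differentiable : Differentiable ℂ h
  bound : ∀ b : ℝ, ∃ C : ℝ, ∀ z : ℂ, |z.re| ≤ b → ‖h z‖ ≤ C * Real.exp |z.im|

/-- The integral over a vertical line against the density `1 / (2 cosh (π u))`. -/
def lineIntegral (h : ℂ → ℂ) (σ : ℝ) : ℂ :=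
  ∫ u : ℝ, h (σ + u * Complex.I) / (2 * Complex.cosh (Real.pi * u))

lemma Tame.comp_add {h : ℂ → ℂ} (hh : Tame h) (m : ℝ) : Tame fun z => h (z + m) where
  differentiable := hh.differentiable.comp (by fun_prop)
  bound b := by
    obtain ⟨C, hC⟩ := hh.bound (b + |m|)
    refine ⟨C, fun z hz => ?_⟩
    have := hC (z + m) (by
      simp only [Complex.add_re, Complex.ofReal_re]
      exact (abs_add_le _ _).trans (by linarith))
    simpa using this

lemma Tame.mul_const {h : ℂ → ℂ} (hh : Tame h) (d : ℂ) : Tame fun z => h z * d where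
  differentiable := hh.differentiable.mul_const d
  bound b := by
    obtain ⟨C, hC⟩ := hh.bound b
    refine ⟨C * ‖d‖, fun z hz => ?_⟩
    rw [norm_mul, mul_right_comm]
    exact mul_le_mul_of_nonneg_right (hC z hz) (norm_nonneg _)

lemma norm_pow_le_exp (k : ℕ) (b : ℝ) (z : ℂ) (hz : |z.re| ≤ b) :
    ‖z ^ k‖ ≤ k.factorial * Real.exp b * Real.exp |z.im| := by
  have h1 : ‖z‖ ≤ b + |z.im| := (Complex.norm_le_abs_re_add_abs_im z).trans (by linarith)
  have h2 := Real.pow_div_factorial_le_exp ‖z‖ (norm_nonneg z) k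
  rw [div_le_iff₀ (by positivity)] at h2
  rw [norm_pow, mul_assoc, ← Real.exp_add, mul_comm]
  exact h2.trans (by gcongr)

lemma norm_eval_le_exp (p : Polynomial ℂ) (b : ℝ) :
    ∃ C : ℝ, ∀ z : ℂ, |z.re| ≤ b → ‖p.eval z‖ ≤ C * Real.exp |z.im| := by
  refine ⟨∑ k ∈ Finset.range (p.natDegree + 1), ‖p.coeff k‖ * (k.factorial * Real.exp b),
    fun z hz => ?_⟩
  rw [Polynomial.eval_eq_sum_range, Finset.sum_mul]
  refine (norm_sum_le _ _).trans (Finset.sum_le_sum fun k _ => ?_)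
  rw [norm_mul, mul_assoc]
  exact mul_le_mul_of_nonneg_left (norm_pow_le_exp k b z hz) (norm_nonneg _)

/-- For c > 0 the modulus of c^(-z) depends only on Re z, so only the polynomial grows along a
strip. -/
lemma tame_eval_mul_cpow (p : Polynomial ℂ) {c : ℝ} (hc : 0 < c) :
    Tame fun z => p.eval z * (c : ℂ) ^ (-z) where
  differentiable := by
    have : Differentiable ℂ fun z : ℂ => (c : ℂ) ^ (-z) := fun z =>
      differentiableAt_id.neg.const_cpow (Or.inl (by exact_mod_cast hc.ne'))
    exact p.differentiable.mul this
  bound b := by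
    obtain ⟨C, hC⟩ := norm_eval_le_exp p b
    refine ⟨C * Real.exp (|Real.log c| * b), fun z hz => ?_⟩
    rw [norm_mul, Complex.norm_cpow_eq_rpow_re_of_pos hc, Real.rpow_def_of_pos hc, mul_right_comm]
    refine mul_le_mul (hC z hz) (Real.exp_le_exp.2 ?_) (Real.exp_nonneg _)
      ((norm_nonneg _).trans (hC z hz))
    refine (le_abs_self _).trans ?_
    rw [abs_mul, Complex.neg_re, abs_neg]
    gcongr

lemma integrable_exp_neg_abs : Integrable fun u : ℝ => Real.exp (-|u|) := by
  refine ((integrable_inv_one_add_sq).const_mul 2).mono' (by fun_prop)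
    (Filter.Eventually.of_forall fun u => ?_)
  rw [Real.norm_of_nonneg (Real.exp_nonneg _), Real.exp_neg, ← div_eq_mul_inv,
    inv_le_comm₀ (Real.exp_pos _) (by positivity), inv_div]
  have := Real.quadratic_le_exp_of_nonneg (abs_nonneg u)
  rw [sq_abs] at this
  have := abs_nonneg u
  linarith

lemma cosh_ofReal_ne_zero (u : ℝ) : Complex.cosh (Real.pi * u) ≠ 0 := by
  rw [← Complex.ofReal_mul, ← Complex.ofReal_cosh]
  exact_mod_cast (Real.cosh_pos _).ne'

lemma exp_abs_le_norm_cosh (u : ℝ) :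
    Real.exp (2 * |u|) ≤ ‖2 * Complex.cosh (Real.pi * u)‖ := by
  rw [← Complex.ofReal_mul, ← Complex.ofReal_cosh, norm_mul, Complex.norm_real,
    Real.norm_of_nonneg (Real.cosh_pos _).le, ← Real.cosh_abs, Real.cosh_eq, abs_mul,
    abs_of_pos Real.pi_pos]
  have h1 : Real.exp (2 * |u|) ≤ Real.exp (Real.pi * |u|) :=
    Real.exp_le_exp.2 (mul_le_mul_of_nonneg_right Real.two_le_pi (abs_nonneg u))
  have h2 := Real.exp_pos (-(Real.pi * |u|))
  norm_num
  linarith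

lemma Tame.continuous_line {h : ℂ → ℂ} (hh : Tame h) (σ : ℝ) :
    Continuous fun u : ℝ => h (σ + u * Complex.I) / (2 * Complex.cosh (Real.pi * u)) := by
  refine Continuous.div (hh.differentiable.continuous.comp (by fun_prop)) (by fun_prop) fun u => ?_
  exact mul_ne_zero two_ne_zero (cosh_ofReal_ne_zero u)

lemma Tame.integrable_line {h : ℂ → ℂ} (hh : Tame h) (σ : ℝ) :
    Integrable fun u : ℝ => h (σ + u * Complex.I) / (2 * Complex.cosh (Real.pi * u)) := by
  obtain ⟨C, hC⟩ := hh.bound |σ|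
  refine (integrable_exp_neg_abs.const_mul C).mono' (hh.continuous_line σ).aestronglyMeasurable
    (Filter.Eventually.of_forall fun u => ?_)
  have h1 := hC (σ + u * Complex.I) (by simp)
  simp only [Complex.add_im, Complex.ofReal_im, Complex.mul_im, Complex.ofReal_re, Complex.I_im,
    mul_one, Complex.I_re, mul_zero, add_zero, zero_add] at h1
  have h2 := exp_abs_le_norm_cosh u
  rw [norm_div, div_le_iff₀ (lt_of_lt_of_le (Real.exp_pos _) h2)]
  have hC0 : 0 ≤ C := by
    by_contra hc
    have := mul_neg_of_neg_of_pos (not_le.1 hc) (Real.exp_pos |u|)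
    linarith [norm_nonneg (h (σ + u * Complex.I))]
  calc ‖h (σ + u * Complex.I)‖ ≤ C * Real.exp |u| := h1
    _ = C * Real.exp (-|u|) * Real.exp (2 * |u|) := by
      rw [mul_assoc, ← Real.exp_add]; congr 2; ring
    _ ≤ _ := mul_le_mul_of_nonneg_left h2 (by positivity)

/-- An antiderivative is arctan(exp(πu))/π. -/
lemma integral_inv_two_cosh : ∫ u : ℝ, 1 / (2 * Complex.cosh (Real.pi * u)) = 1 / 2 := by
  have hint : Integrable fun u : ℝ => 1 / (2 * Complex.cosh (Real.pi * u)) := by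
    have ht : Tame fun _ => 1 := ⟨by fun_prop, fun b => ⟨1, fun z _ => by simp⟩⟩
    exact ht.integrable_line 0
  have hre : ∀ u : ℝ, 1 / (2 * Complex.cosh (Real.pi * u)) =
      ((1 / (2 * Real.cosh (Real.pi * u)) : ℝ) : ℂ) := by intro u; push_cast; rfl
  simp only [hre] at hint ⊢
  rw [integral_complex_ofReal]
  have hint' : Integrable fun u : ℝ => 1 / (2 * Real.cosh (Real.pi * u)) := by
    exact hint.re
  have hderiv : ∀ u : ℝ, HasDerivAt (fun u => 1 / Real.pi * Real.arctan (Real.exp (Real.pi * u)))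
      (1 / (2 * Real.cosh (Real.pi * u))) u := by
    intro u
    have h1 : HasDerivAt (fun u : ℝ => Real.pi * u) Real.pi u := by
      simpa using (hasDerivAt_id u).const_mul Real.pi
    refine ((h1.exp.arctan).const_mul (1 / Real.pi)).congr_deriv ?_
    have hp := Real.pi_pos.ne'
    have he := Real.exp_pos (Real.pi * u)
    rw [Real.cosh_eq, Real.exp_neg]
    field_simp
    ring
  have hb : Filter.Tendsto (fun u : ℝ => Real.pi * u) Filter.atBot Filter.atBot :=
    Filter.Tendsto.const_mul_atBot Real.pi_pos Filter.tendsto_id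
  have ht : Filter.Tendsto (fun u : ℝ => Real.pi * u) Filter.atTop Filter.atTop :=
    Filter.Tendsto.const_mul_atTop Real.pi_pos Filter.tendsto_id
  have hbot : Filter.Tendsto (fun u => 1 / Real.pi * Real.arctan (Real.exp (Real.pi * u)))
      Filter.atBot (nhds (1 / Real.pi * Real.arctan 0)) :=
    ((Real.continuous_arctan.tendsto 0).comp (Real.tendsto_exp_atBot.comp hb)).const_mul _
  have htop : Filter.Tendsto (fun u => 1 / Real.pi * Real.arctan (Real.exp (Real.pi * u)))
      Filter.atTop (nhds (1 / Real.pi * (Real.pi / 2))) :=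
    ((Real.tendsto_arctan_atTop.mono_right nhdsWithin_le_nhds).comp
      (Real.tendsto_exp_atTop.comp ht)).const_mul _
  rw [integral_of_hasDerivAt_of_tendsto hderiv hint' hbot htop]
  have hp := Real.pi_pos.ne'
  rw [Real.arctan_zero]
  push_cast
  field_simp
  simp

lemma sin_pi_half_add (u : ℝ) :
    Complex.sin (Real.pi * (((1 / 2 : ℝ) : ℂ) + u * Complex.I)) =
      Complex.cosh (Real.pi * u) := by
  have : (Real.pi * (((1 / 2 : ℝ) : ℂ) + u * Complex.I) : ℂ) =
      Real.pi / 2 + Real.pi * u * Complex.I := by push_cast; ring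
  rw [this, Complex.sin_add_mul_I, Complex.sin_pi_div_two, Complex.cos_pi_div_two]
  ring

lemma sin_pi_neg_half_add (u : ℝ) :
    Complex.sin (Real.pi * (((-(1 / 2) : ℝ) : ℂ) + u * Complex.I)) =
      -Complex.cosh (Real.pi * u) := by
  have h := sin_pi_half_add (-u)
  have h2 : (Real.pi * (((-(1 / 2) : ℝ) : ℂ) + u * Complex.I) : ℂ) =
      -(Real.pi * (((1 / 2 : ℝ) : ℂ) + (-u : ℝ) * Complex.I)) := by push_cast; ring
  rw [h2, Complex.sin_neg, h]
  push_cast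
  rw [mul_neg, Complex.cosh_neg]

/-- Any rate above 1 beats the growth of a tame function; since π > 3, rate 2 holds with a crude
constant once |y| ≥ 1. -/
lemma exp_le_norm_sin (x y : ℝ) (hy : 1 ≤ |y|) :
    Real.exp (2 * |y|) ≤ 4 * ‖Complex.sin (Real.pi * (x + y * Complex.I))‖ := by
  have key : ∀ w : ℂ, Real.exp |w.im| - Real.exp (-|w.im|) ≤ 2 * ‖Complex.sin w‖ := by
    intro w
    have h1 : 2 * ‖Complex.sin w‖ =
        ‖Complex.exp (-w * Complex.I) - Complex.exp (w * Complex.I)‖ := by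
      rw [Complex.sin]
      simp
      ring
    have n1 : ‖Complex.exp (-w * Complex.I)‖ = Real.exp w.im := by simp [Complex.norm_exp]
    have n2 : ‖Complex.exp (w * Complex.I)‖ = Real.exp (-w.im) := by simp [Complex.norm_exp]
    rw [h1]
    rcases le_total 0 w.im with h | h
    · rw [abs_of_nonneg h, ← n1, ← n2]
      exact norm_sub_norm_le _ _
    · rw [abs_of_nonpos h, neg_neg, ← n1, ← n2, norm_sub_rev]
      exact norm_sub_norm_le _ _
  have h := key (Real.pi * (x + y * Complex.I))
  have him : (Real.pi * (x + y * Complex.I) : ℂ).im = Real.pi * y := by simp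
  rw [him, abs_mul, abs_of_pos Real.pi_pos] at h
  have h1 : Real.exp (2 * |y|) + 1 ≤ Real.exp (Real.pi * |y|) := by
    have e : Real.exp (Real.pi * |y|) = Real.exp (2 * |y|) * Real.exp ((Real.pi - 2) * |y|) := by
      rw [← Real.exp_add]; congr 1; ring
    have h3 : 1 + (Real.pi - 2) * |y| ≤ Real.exp ((Real.pi - 2) * |y|) := by
      have := Real.add_one_le_exp ((Real.pi - 2) * |y|); linarith
    have h4 : 2 ≤ Real.exp ((Real.pi - 2) * |y|) := by
      nlinarith [Real.pi_gt_three]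
    have h5 : (1 : ℝ) ≤ Real.exp (2 * |y|) := Real.one_le_exp (by positivity)
    rw [e]
    nlinarith
  have h2 : Real.exp (-(Real.pi * |y|)) ≤ 1 :=
    Real.exp_le_one_iff.2 (neg_nonpos.2 (by positivity))
  have := norm_nonneg (Complex.sin (Real.pi * (x + y * Complex.I)))
  linarith

lemma sin_pi_mul_ne_zero {z : ℂ} (hz : |z.re| ≤ 1 / 2) (h0 : z ≠ 0) :
    Complex.sin (Real.pi * z) ≠ 0 := by
  rw [Complex.sin_ne_zero_iff]
  intro k hk
  have hp : (Real.pi : ℂ) ≠ 0 := by exact_mod_cast Real.pi_pos.ne'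
  have : z = k := by
    rw [mul_comm] at hk
    exact mul_right_cancel₀ hp hk
  rw [this] at hz h0
  have hk1 : |(k : ℝ)| ≤ 1 / 2 := by simpa using hz
  have hk0 : k ≠ 0 := by rintro rfl; simp at h0
  have : (1 : ℝ) ≤ |(k : ℝ)| := by exact_mod_cast Int.one_le_abs hk0
  linarith

/-- Cauchy's theorem for (h - h 0)/sin(πz), whose singularity at 0 is removable, on tall rectangles
over |Re z| ≤ 1/2. The subtracted constant is restored by `integral_inv_two_cosh`. The lines enter
with a plus sign because sin(πz) is cosh on one and -cosh on the other. -/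
lemma Tame.lineIntegral_half {h : ℂ → ℂ} (hh : Tame h) :
    lineIntegral h (1 / 2) + lineIntegral h (-(1 / 2)) = h 0 := by
  set k := dslope h 0
  set S := dslope (fun z : ℂ => Complex.sin (Real.pi * z)) 0
  have hk : Differentiable ℂ k := by
    rw [← differentiableOn_univ, Complex.differentiableOn_dslope Filter.univ_mem]
    exact hh.differentiable.differentiableOn
  have hsin : Differentiable ℂ fun z : ℂ => Complex.sin (Real.pi * z) := by fun_prop
  have hS : Differentiable ℂ S := by
    rw [← differentiableOn_univ, Complex.differentiableOn_dslope Filter.univ_mem]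
    exact hsin.differentiableOn
  have hS0 : ∀ z : ℂ, |z.re| ≤ 1 / 2 → S z ≠ 0 := by
    intro z hz
    by_cases h0 : z = 0
    · have hd : HasDerivAt (fun z : ℂ => Complex.sin (Real.pi * z))
          (Complex.cos (Real.pi * 0) * (Real.pi * 1)) 0 :=
        ((hasDerivAt_id (0 : ℂ)).const_mul (Real.pi : ℂ)).csin
      rw [h0]
      simp only [S, dslope_same, hd.deriv]
      simp [Real.pi_pos.ne']
    · rw [show S z = _ from dslope_of_ne _ h0, slope_def_field]
      simpa using ⟨sin_pi_mul_ne_zero hz h0, h0⟩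
  -- The quotient of the two divided slopes is the holomorphic extension of (h - h 0)/sin(πz) across
  -- 0.
  have hf : ∀ z : ℂ, z ≠ 0 → k z / S z = (h z - h 0) / Complex.sin (Real.pi * z) := by
    intro z hz
    rw [show S z = _ from dslope_of_ne _ hz, show k z = _ from dslope_of_ne _ hz, slope_def_field,
      slope_def_field]
    simp
    field_simp
  have hd : ∀ T : ℝ, DifferentiableOn ℂ (fun z => k z / S z)
      (Set.uIcc (-(1 / 2 : ℝ)) (1 / 2) ×ℂ Set.uIcc (-T) T) := by
    intro T
    refine hk.differentiableOn.div hS.differentiableOn fun z hz => hS0 z ?_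
    have := hz.1
    rw [Set.mem_preimage, Set.uIcc_of_le (by norm_num)] at this
    exact abs_le.2 this
  obtain ⟨C, hC⟩ := hh.bound (1 / 2)
  have hC0 : 0 ≤ C := by
    have := hC 0 (by simp)
    simp at this
    exact (norm_nonneg _).trans this
  have hbound : ∀ x y : ℝ, |x| ≤ 1 / 2 → 1 ≤ |y| →
      ‖k (x + y * Complex.I) / S (x + y * Complex.I)‖ ≤
        4 * (C + ‖h 0‖) * Real.exp (-|y|) := by
    intro x y hx hy
    have hz : (x + y * Complex.I : ℂ) ≠ 0 := by
      intro h0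
      have := congrArg Complex.im h0
      simp at this
      rw [this] at hy
      norm_num at hy
    rw [hf _ hz, norm_div]
    have h1 := exp_le_norm_sin x y hy
    have hpos : 0 < ‖Complex.sin (Real.pi * (x + y * Complex.I))‖ := by
      have := Real.exp_pos (2 * |y|); linarith
    rw [div_le_iff₀ hpos]
    have h2 := hC (x + y * Complex.I) (by simpa using hx)
    simp only [Complex.add_im, Complex.ofReal_im, Complex.mul_im, Complex.ofReal_re, Complex.I_im,
      mul_one, Complex.I_re, mul_zero, add_zero, zero_add] at h2
    have h3 : (1 : ℝ) ≤ Real.exp |y| := Real.one_le_exp (abs_nonneg y)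
    have h4 : Real.exp (-|y|) * Real.exp (2 * |y|) = Real.exp |y| := by
      rw [← Real.exp_add]; congr 1; ring
    calc ‖h (x + y * Complex.I) - h 0‖ ≤ ‖h (x + y * Complex.I)‖ + ‖h 0‖ := norm_sub_le _ _
      _ ≤ C * Real.exp |y| + ‖h 0‖ * Real.exp |y| :=
        add_le_add h2 (le_mul_of_one_le_right (norm_nonneg _) h3)
      _ = (C + ‖h 0‖) * Real.exp (-|y|) * Real.exp (2 * |y|) := by rw [mul_assoc, h4]; ring
      _ ≤ (C + ‖h 0‖) * Real.exp (-|y|) *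
          (4 * ‖Complex.sin (Real.pi * (x + y * Complex.I))‖) :=
        mul_le_mul_of_nonneg_left h1 (by positivity)
      _ = _ := by ring
  have hexp : Filter.Tendsto (fun T : ℝ => 4 * (C + ‖h 0‖) * Real.exp (-|T|))
      Filter.atTop (nhds 0) := by
    have : Filter.Tendsto (fun T : ℝ => Real.exp (-|T|)) Filter.atTop (nhds 0) :=
      Real.tendsto_exp_neg_atTop_nhds_zero.comp Filter.tendsto_abs_atTop_atTop
    simpa using this.const_mul (4 * (C + ‖h 0‖))
  have hhor : ∀ e : ℝ, |e| = 1 → Filter.Tendsto (fun T : ℝ => ∫ x : ℝ in (-(1 / 2 : ℝ))..(1 / 2),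
      k (x + (e * T : ℝ) * Complex.I) / S (x + (e * T : ℝ) * Complex.I))
      Filter.atTop (nhds 0) := by
    intro e he
    refine squeeze_zero_norm' ?_ hexp
    filter_upwards [Filter.eventually_ge_atTop (1 : ℝ)] with T hT
    have habs : |e * T| = |T| := by rw [abs_mul, he, one_mul]
    have := intervalIntegral.norm_integral_le_of_norm_le_const (a := -(1 / 2 : ℝ)) (b := 1 / 2)
      (C := 4 * (C + ‖h 0‖) * Real.exp (-|T|))
      (f := fun x : ℝ => k (x + (e * T : ℝ) * Complex.I) / S (x + (e * T : ℝ) * Complex.I))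
      (fun x hx => by
        rw [Set.uIoc_of_le (by norm_num)] at hx
        rw [← habs]
        exact hbound x (e * T) (abs_le.2 ⟨hx.1.le, hx.2⟩)
          (by rw [habs]; exact hT.trans (le_abs_self T)))
    refine this.trans (le_of_eq ?_)
    norm_num
  have hone : Tame fun _ => 1 := ⟨by fun_prop, fun b => ⟨1, fun z _ => by simp⟩⟩
  have hi1 := hh.integrable_line (1 / 2)
  have hi2 := hh.integrable_line (-(1 / 2))
  have hi0 := hone.integrable_line 0
  have hr : ∀ y : ℝ, k ((1 / 2 : ℝ) + y * Complex.I) / S ((1 / 2 : ℝ) + y * Complex.I) =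
      2 * (h ((1 / 2 : ℝ) + y * Complex.I) / (2 * Complex.cosh (Real.pi * y)) -
        h 0 * (1 / (2 * Complex.cosh (Real.pi * y)))) := by
    intro y
    have hne : ((1 / 2 : ℝ) + y * Complex.I : ℂ) ≠ 0 := by
      intro h0
      have := congrArg Complex.re h0
      simp at this
    have := cosh_ofReal_ne_zero y
    rw [hf _ hne, sin_pi_half_add]
    field_simp
  have hl : ∀ y : ℝ, k ((-(1 / 2) : ℝ) + y * Complex.I) / S ((-(1 / 2) : ℝ) + y * Complex.I) =
      -2 * (h ((-(1 / 2) : ℝ) + y * Complex.I) / (2 * Complex.cosh (Real.pi * y)) -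
        h 0 * (1 / (2 * Complex.cosh (Real.pi * y)))) := by
    intro y
    have hne : ((-(1 / 2) : ℝ) + y * Complex.I : ℂ) ≠ 0 := by
      intro h0
      have := congrArg Complex.re h0
      simp at this
    have := cosh_ofReal_ne_zero y
    rw [hf _ hne, sin_pi_neg_half_add]
    field_simp
  have hir : Integrable fun y : ℝ =>
      k ((1 / 2 : ℝ) + y * Complex.I) / S ((1 / 2 : ℝ) + y * Complex.I) := by
    simp only [hr]
    exact (hi1.sub (hi0.const_mul (h 0))).const_mul 2
  have hil : Integrable fun y : ℝ =>
      k ((-(1 / 2) : ℝ) + y * Complex.I) / S ((-(1 / 2) : ℝ) + y * Complex.I) := by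
    simp only [hl]
    exact (hi2.sub (hi0.const_mul (h 0))).const_mul (-2)
  have hvr : ∫ y : ℝ, k ((1 / 2 : ℝ) + y * Complex.I) / S ((1 / 2 : ℝ) + y * Complex.I) =
      2 * (lineIntegral h (1 / 2) - h 0 * (1 / 2)) := by
    simp only [hr]
    rw [integral_const_mul, integral_sub hi1 (hi0.const_mul (h 0)), integral_const_mul,
      integral_inv_two_cosh, lineIntegral]
  have hvl : ∫ y : ℝ, k ((-(1 / 2) : ℝ) + y * Complex.I) / S ((-(1 / 2) : ℝ) + y * Complex.I) =
      -2 * (lineIntegral h (-(1 / 2)) - h 0 * (1 / 2)) := by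
    simp only [hl]
    rw [integral_const_mul, integral_sub hi2 (hi0.const_mul (h 0)), integral_const_mul,
      integral_inv_two_cosh, lineIntegral]
  have hlim := (((hhor (-1) (by simp)).sub (hhor 1 (by simp))).add
    ((intervalIntegral_tendsto_integral hir Filter.tendsto_neg_atTop_atBot
      Filter.tendsto_id).const_smul Complex.I)).sub
    ((intervalIntegral_tendsto_integral hil Filter.tendsto_neg_atTop_atBot
      Filter.tendsto_id).const_smul Complex.I)
  have hzero := fun T : ℝ => Complex.integral_boundary_rect_eq_zero_of_differentiableOn
    (fun z => k z / S z) ⟨-(1 / 2), -T⟩ ⟨1 / 2, T⟩ (hd T)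
  have heq := tendsto_nhds_unique hlim ((tendsto_const_nhds (x := (0 : ℂ))).congr fun T => by
    have h0 := hzero T
    dsimp only at h0
    rw [← h0]
    simp only [neg_mul, one_mul, id])
  rw [hvr, hvl] at heq
  simp only [sub_self, zero_add, smul_eq_mul] at heq
  have : Complex.I * (2 * (lineIntegral h (1 / 2) + lineIntegral h (-(1 / 2)) - h 0)) = 0 := by
    linear_combination heq
  have h2 := (mul_eq_zero.1 this).resolve_left Complex.I_ne_zero
  have h3 := (mul_eq_zero.1 h2).resolve_left two_ne_zero
  exact sub_eq_zero.1 h3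

/-- Shifting the line of integration by one picks up a residue. -/
lemma Tame.lineIntegral_add_lineIntegral {h : ℂ → ℂ} (hh : Tame h) (m : ℝ) :
    lineIntegral h (m + 1 / 2) + lineIntegral h (m - 1 / 2) = h m := by
  have := (hh.comp_add m).lineIntegral_half
  simp only [lineIntegral, zero_add] at this ⊢
  rw [← this]
  congr 3
  · ext u; congr 2; push_cast; ring
  · ext u; congr 2; push_cast; ring

/-! ### Inverting the Bernoulli average; the biorthogonal polynomials. -/

lemma tame_poch_mul_eval (q : Polynomial ℂ) {c : ℝ} (hc : 0 < c) (n : ℕ) (r x d : ℂ) :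
    Tame fun v => poch (v + r) n / d * q.eval (x + v) * (c : ℂ) ^ (-v) := by
  have h := (tame_eval_mul_cpow ((ascPochhammer ℂ n).comp (Polynomial.X + Polynomial.C r) *
    q.comp (Polynomial.C x + Polynomial.X)) hc).mul_const d⁻¹
  convert h using 1
  ext v
  simp [poch]
  ring

/-- The vertical line integral that inverts `n + 1` Bernoulli averaging steps, up to a constant. -/
def inverseAvg (c : ℝ) (q : Polynomial ℂ) (n : ℕ) (x : ℂ) : ℂ :=
  lineIntegral (fun v => poch (v + 1) n / n.factorial * q.eval (x + v) * (c : ℂ) ^ (-v))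
    (-(n : ℝ) - 1 / 2)

lemma poch_sub_poch (n : ℕ) (w : ℂ) :
    poch w (n + 1) - poch (w + 1) (n + 1) = -((n + 1) * poch (w + 1) n) := by
  have h1 : poch w (n + 1) = w * poch (w + 1) n := by
    rw [poch, ascPochhammer_succ_left]; simp [poch]
  have h2 : poch (w + 1) (n + 1) = poch (w + 1) n * (w + 1 + n) := by
    rw [poch, ascPochhammer_succ_right]; simp [poch]
  rw [h1, h2]
  ring

lemma lineIntegral_comp_add_one (h : ℂ → ℂ) (σ : ℝ) :
    lineIntegral (fun v => h (v + 1)) σ = lineIntegral h (σ + 1) := by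
  simp only [lineIntegral]
  congr 1
  ext u
  congr 2
  push_cast
  ring

lemma lineIntegral_const_mul (h : ℂ → ℂ) (d : ℂ) (σ : ℝ) :
    lineIntegral (fun v => d * h v) σ = d * lineIntegral h σ := by
  simp only [lineIntegral, mul_div_assoc]
  rw [integral_const_mul]

/-- The substitution v ↦ v - 1 turns the shift of x into a shift of the line and a factor c; then βc
= 1 - β makes the two terms of `avg` comparable. -/
lemma inverseAvg_add_one {c : ℝ} (hc : 0 < c) (q : Polynomial ℂ) (n : ℕ) (x : ℂ) :
    inverseAvg c q n (x + 1) =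
      c * lineIntegral (fun v => poch v n / n.factorial * q.eval (x + v) * (c : ℂ) ^ (-v))
        (-(n : ℝ) + 1 / 2) := by
  have hc0 : (c : ℂ) ≠ 0 := by exact_mod_cast hc.ne'
  have h := lineIntegral_comp_add_one
    (fun v => c * (poch v n / n.factorial * q.eval (x + v) * (c : ℂ) ^ (-v))) (-(n : ℝ) - 1 / 2)
  rw [(by ring : -(n : ℝ) - 1 / 2 + 1 = -(n : ℝ) + 1 / 2)] at h
  rw [← lineIntegral_const_mul, ← h, inverseAvg]
  congr 1
  ext v
  have : (c : ℂ) ^ (-v) = c * (c : ℂ) ^ (-(v + 1)) := by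
    rw [neg_add, Complex.cpow_add _ _ hc0, Complex.cpow_neg_one]
    field_simp
  rw [this, (by ring : x + (v + 1) = x + 1 + v)]
  ring

lemma mul_div_cancel_beta {β : ℝ} (hβ₀ : 0 < β) : (β : ℂ) * (((1 - β) / β : ℝ) : ℂ) = 1 - β := by
  have : (β : ℂ) ≠ 0 := by exact_mod_cast hβ₀.ne'
  push_cast
  field_simp

lemma avg_inverseAvg_zero {β : ℝ} (hβ₀ : 0 < β) (hβ₁ : β < 1) (q : Polynomial ℂ) (x : ℤ) :
    avg β (fun x : ℤ => inverseAvg ((1 - β) / β) q 0 x) x = (1 - β) * q.eval (x : ℂ) := by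
  have hc : 0 < (1 - β) / β := div_pos (by linarith) hβ₀
  have ht := (tame_poch_mul_eval q hc 0 1 x 1).lineIntegral_add_lineIntegral 0
  rw [avg]
  push_cast
  rw [inverseAvg_add_one hc, ← mul_assoc, mul_div_cancel_beta hβ₀, inverseAvg, ← mul_add, add_comm]
  congr 1
  simp only [poch, ascPochhammer_zero, Polynomial.eval_one] at ht ⊢
  simpa using ht

lemma avg_inverseAvg_succ {β : ℝ} (hβ₀ : 0 < β) (hβ₁ : β < 1) (q : Polynomial ℂ) (n : ℕ) (x : ℤ) :
    avg β (fun x : ℤ => inverseAvg ((1 - β) / β) q (n + 1) x) x =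
      -(1 - β) * inverseAvg ((1 - β) / β) q n x := by
  have hc : 0 < (1 - β) / β := div_pos (by linarith) hβ₀
  set c := (1 - β) / β with hcdef
  have h1 := tame_poch_mul_eval q hc (n + 1) 1 x (n + 1).factorial
  have h2 : Tame fun v : ℂ => poch v (n + 1) / (n + 1).factorial * q.eval (x + v) *
      (c : ℂ) ^ (-v) := by
    simpa using tame_poch_mul_eval q hc (n + 1) 0 x (n + 1).factorial
  have ht := h1.lineIntegral_add_lineIntegral (-((n + 1 : ℕ) : ℝ))
  -- The Pochhammer factor vanishes at the pole that is crossed, so both integrals can be put on the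
  -- same line without a residue. There `poch_sub_poch` lowers the order by one.
  have hz : poch (((-((n + 1 : ℕ) : ℝ) : ℝ) : ℂ) + 1) (n + 1) = 0 := by
    rw [poch, ascPochhammer_succ_right]
    simp
  rw [hz, zero_div, zero_mul, zero_mul] at ht
  have hdiff : lineIntegral (fun v => poch v (n + 1) / (n + 1).factorial * q.eval (x + v) *
        (c : ℂ) ^ (-v)) (-((n + 1 : ℕ) : ℝ) + 1 / 2) -
      lineIntegral (fun v => poch (v + 1) (n + 1) / (n + 1).factorial * q.eval (x + v) *
        (c : ℂ) ^ (-v)) (-((n + 1 : ℕ) : ℝ) + 1 / 2) = -inverseAvg c q n x := by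
    have hσ : -((n + 1 : ℕ) : ℝ) + 1 / 2 = -(n : ℝ) - 1 / 2 := by push_cast; ring
    rw [hσ, lineIntegral, lineIntegral, inverseAvg, lineIntegral,
      ← integral_sub (h2.integrable_line _) (h1.integrable_line _), ← integral_neg]
    congr 1
    ext u
    set v : ℂ := ((-(n : ℝ) - 1 / 2 : ℝ) : ℂ) + u * Complex.I
    have hp := poch_sub_poch n v
    have hn : ((n + 1 : ℕ).factorial : ℂ) = (n + 1) * n.factorial := by
      push_cast [Nat.factorial_succ]; ring
    have hn0 : (n.factorial : ℂ) ≠ 0 := by exact_mod_cast n.factorial_ne_zero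
    have hn1 : (n + 1 : ℂ) ≠ 0 := by exact_mod_cast n.succ_ne_zero
    have hc0 := cosh_ofReal_ne_zero u
    rw [hn]
    field_simp
    linear_combination (q.eval (x + v) * (c : ℂ) ^ (-v)) * hp
  rw [avg]
  push_cast
  rw [inverseAvg_add_one hc, ← mul_assoc, mul_div_cancel_beta hβ₀]
  rw [inverseAvg]
  linear_combination (1 - (β : ℂ)) * (hdiff + ht)

lemma exists_inverseAvg_eq_sum {c : ℝ} (hc : 0 < c) (q : Polynomial ℂ) {N : ℕ}
    (hq : q.natDegree < N) (n : ℕ) :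
    ∃ b : Fin N → ℂ, ∀ x : ℤ, inverseAvg c q n x = ∑ k : Fin N, b k * (x : ℂ) ^ (k : ℕ) := by
  let h : ℕ → ℂ → ℂ := fun k v => poch (v + 1) n / n.factorial *
    (Polynomial.hasseDeriv k q).eval v * (c : ℂ) ^ (-v)
  have hh : ∀ k, Tame (h k) := fun k => by
    simpa using tame_poch_mul_eval (Polynomial.hasseDeriv k q) hc n 1 0 n.factorial
  refine ⟨fun k => lineIntegral (h k) (-(n : ℝ) - 1 / 2), fun x => ?_⟩
  rw [Fin.sum_univ_eq_sum_range
    (fun k => lineIntegral (h k) (-(n : ℝ) - 1 / 2) * (x : ℂ) ^ k) N]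
  simp only [lineIntegral, inverseAvg, ← integral_mul_const]
  rw [← integral_finsetSum _ fun k _ => ((hh k).integrable_line _).mul_const _]
  congr 1
  ext u
  set v : ℂ := ((-(n : ℝ) - 1 / 2 : ℝ) : ℂ) + u * Complex.I
  -- Taylor expansion at v separates x from the integration variable, so the integral is a
  -- polynomial in x of degree below N.
  have he : q.eval ((x : ℂ) + v) =
      ∑ k ∈ Finset.range N, (Polynomial.hasseDeriv k q).eval v * (x : ℂ) ^ k := by
    rw [← Polynomial.taylor_eval,
      Polynomial.eval_eq_sum_range' (by rwa [Polynomial.natDegree_taylor])]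
    simp only [Polynomial.taylor_coeff]
  rw [he, Finset.mul_sum, Finset.sum_mul, Finset.sum_div]
  refine Finset.sum_congr rfl fun k _ => ?_
  simp only [h]
  ring

/-- The Lagrange polynomial that is `1` at `a j` and `0` at the other entries of `a`. -/
def lagrange {N : ℕ} (a : Weyl N) (j : Fin N) : Polynomial ℂ :=
  Lagrange.basis Finset.univ (fun i => (a.1 i : ℂ)) j

lemma injective_cast {N : ℕ} (a : Weyl N) : Function.Injective fun i => (a.1 i : ℂ) :=
  Int.cast_injective.comp a.2.injective

/-- The polynomials biorthogonal to the Bernoulli weights started from `a`. -/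
def biorth {N : ℕ} (β : ℝ) (a : Weyl N) : ℕ → Fin N → ℤ → ℂ
  | 0, j, x => (lagrange a j).eval (x : ℂ)
  | n + 1, j, x => (-1) ^ n / (1 - β : ℂ) ^ (n + 1) *
      inverseAvg ((1 - β) / β) (lagrange a j) n x

lemma natDegree_lagrange_lt {N : ℕ} (a : Weyl N) (j : Fin N) : (lagrange a j).natDegree < N := by
  have hN : 0 < N := j.pos
  rw [lagrange, Lagrange.natDegree_basis (injective_cast a).injOn (Finset.mem_univ j)]
  simp
  omega

lemma biorth_zero {N : ℕ} (β : ℝ) (a : Weyl N) (i j : Fin N) :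
    biorth β a 0 j (a.1 i) = if i = j then 1 else 0 := by
  rw [biorth, lagrange]
  split_ifs with h
  · subst h
    exact Lagrange.eval_basis_self (injective_cast a).injOn (Finset.mem_univ i)
  · exact Lagrange.eval_basis_of_ne (v := fun i => (a.1 i : ℂ)) (fun h' => h h'.symm)
      (Finset.mem_univ i)

lemma exists_biorth_eq_sum {N : ℕ} {β : ℝ} (hβ₀ : 0 < β) (hβ₁ : β < 1) (a : Weyl N) (t : ℕ)
    (j : Fin N) :
    ∃ b : Fin N → ℂ, ∀ x : ℤ, biorth β a t j x = ∑ k : Fin N, b k * (x : ℂ) ^ (k : ℕ) := by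
  cases t with
  | zero =>
    refine ⟨fun k => (lagrange a j).coeff k, fun x => ?_⟩
    rw [biorth, Polynomial.eval_eq_sum_range' (natDegree_lagrange_lt a j),
      Fin.sum_univ_eq_sum_range (fun k => (lagrange a j).coeff k * (x : ℂ) ^ k) N]
  | succ n =>
    obtain ⟨b, hb⟩ := exists_inverseAvg_eq_sum (div_pos (by linarith) hβ₀ : 0 < (1 - β) / β)
      (lagrange a j) (natDegree_lagrange_lt a j) n
    refine ⟨fun k => (-1) ^ n / (1 - β : ℂ) ^ (n + 1) * b k, fun x => ?_⟩
    simp only [biorth, hb, Finset.mul_sum, mul_assoc]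

lemma avg_biorth {N : ℕ} {β : ℝ} (hβ₀ : 0 < β) (hβ₁ : β < 1) (a : Weyl N) (t : ℕ)
    (j : Fin N) (x : ℤ) : avg β (biorth β a (t + 1) j) x = biorth β a t j x := by
  have hb : (1 - β : ℂ) ≠ 0 := by
    have : (1 - β : ℝ) ≠ 0 := by linarith
    exact_mod_cast this
  have hcm : ∀ (d : ℂ) (f : ℤ → ℂ), avg β (fun n => d * f n) x = d * avg β f x := fun d f => by
    simp only [avg]; ring
  have hdef : ∀ n, biorth β a (n + 1) j = fun x : ℤ => (-1) ^ n / (1 - β : ℂ) ^ (n + 1) *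
      inverseAvg ((1 - β) / β) (lagrange a j) n x := fun n => rfl
  rw [hdef, hcm]
  cases t with
  | zero =>
    rw [avg_inverseAvg_zero hβ₀ hβ₁, biorth]
    field_simp
    simp
  | succ n =>
    rw [avg_inverseAvg_succ hβ₀ hβ₁, hdef]
    field_simp
    ring

/-! ### Partial fractions and residues at integers. -/

lemma exists_eq_prod_mul {f : ℂ → ℂ} (hf : Differentiable ℂ f) (B : Finset ℤ)
    (hB : ∀ n ∈ B, f n = 0) :
    ∃ g : ℂ → ℂ, Differentiable ℂ g ∧ ∀ w, f w = (∏ n ∈ B, (w - (n : ℂ))) * g w := by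
  induction B using Finset.induction_on with
  | empty => exact ⟨f, hf, fun w => by simp⟩
  | insert b B hb ih =>
    obtain ⟨g, hg, hfg⟩ := ih fun n hn => hB n (Finset.mem_insert_of_mem hn)
    have hgb : g b = 0 := by
      have h1 := hfg b
      rw [hB b (Finset.mem_insert_self b B)] at h1
      refine (mul_eq_zero.1 h1.symm).resolve_left (Finset.prod_ne_zero_iff.2 fun n hn => ?_)
      rw [sub_ne_zero]
      intro h
      rw [Int.cast_injective h] at hb
      exact hb hn
    refine ⟨dslope g b, ?_, fun w => ?_⟩
    · rw [← differentiableOn_univ, Complex.differentiableOn_dslope Filter.univ_mem]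
      exact hg.differentiableOn
    · have h1 := sub_smul_dslope g (b : ℂ) w
      rw [hgb, sub_zero, smul_eq_mul] at h1
      rw [hfg, Finset.prod_insert hb, ← h1]
      ring

/-- Partial fractions: divide the identity that the Lagrange basis sums to 1 by the nodal product.
-/
lemma inv_prod_eq_sum {S : Finset ℤ} (hS : S.Nonempty) {w : ℂ} (hw : ∀ n ∈ S, w ≠ (n : ℂ)) :
    (∏ n ∈ S, (w - (n : ℂ)))⁻¹ =
      ∑ s ∈ S, (∏ n ∈ S.erase s, ((s : ℂ) - n))⁻¹ * (w - (s : ℂ))⁻¹ := by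
  have h1 := congrArg (Polynomial.eval w)
    (Lagrange.sum_basis (F := ℂ) (v := fun n : ℤ => (n : ℂ)) (s := S)
      Int.cast_injective.injOn hS)
  rw [Polynomial.eval_finsetSum, Polynomial.eval_one] at h1
  have hne : ∏ n ∈ S, (w - (n : ℂ)) ≠ 0 :=
    Finset.prod_ne_zero_iff.2 fun n hn => sub_ne_zero.2 (hw n hn)
  rw [← one_mul (∏ n ∈ S, (w - (n : ℂ)))⁻¹, ← h1, Finset.sum_mul]
  refine Finset.sum_congr rfl fun s hs => ?_
  have hws := sub_ne_zero.2 (hw s hs)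
  rw [← Finset.mul_prod_erase S _ hs] at hne ⊢
  have hne' := (mul_ne_zero_iff.1 hne).2
  have he : (Lagrange.basis S (fun n : ℤ => (n : ℂ)) s).eval w =
      (∏ n ∈ S.erase s, ((s : ℂ) - n))⁻¹ * ∏ n ∈ S.erase s, (w - (n : ℂ)) := by
    rw [Lagrange.basis, Polynomial.eval_prod, ← Finset.prod_inv_distrib,
      ← Finset.prod_mul_distrib]
    refine Finset.prod_congr rfl fun n _ => ?_
    simp [Lagrange.basisDivisor]
  rw [he, mul_inv]
  field_simp

lemma continuousOn_div_prod {S : Finset ℤ} {h : ℂ → ℂ} {c : ℂ} {r : ℝ}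
    (hh : ∀ w ∈ Metric.closedBall c r, DifferentiableAt ℂ h w)
    (hS : ∀ n : ℤ, (n : ℂ) ∉ Metric.sphere c r) :
    ContinuousOn (fun w => h w / ∏ n ∈ S, (w - (n : ℂ))) (Metric.sphere c r) := by
  refine ContinuousOn.div
    (fun w hw => (hh w (Metric.sphere_subset_closedBall hw)).continuousAt.continuousWithinAt)
    (by fun_prop) fun w hw => Finset.prod_ne_zero_iff.2 fun n _ => sub_ne_zero.2 ?_
  rintro rfl
  exact hS n hw

open Classical in
/-- The residue theorem for finitely many simple poles at integers. -/
lemma circleIntegral_div_prod {S : Finset ℤ} {h : ℂ → ℂ} {c : ℂ} {r : ℝ} (hr : 0 ≤ r)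
    (hh : ∀ w ∈ Metric.closedBall c r, DifferentiableAt ℂ h w)
    (hS : ∀ n : ℤ, (n : ℂ) ∉ Metric.sphere c r) :
    ∮ w in C(c, r), h w / ∏ n ∈ S, (w - (n : ℂ)) =
      2 * Real.pi * Complex.I * ∑ s ∈ S, if (s : ℂ) ∈ Metric.ball c r then
        h s / ∏ n ∈ S.erase s, ((s : ℂ) - n) else 0 := by
  have hcont : ContinuousOn h (Metric.closedBall c r) := fun w hw =>
    (hh w hw).continuousAt.continuousWithinAt
  have hdiff : ∀ w ∈ Metric.ball c r \ (∅ : Set ℂ), DifferentiableAt ℂ h w := fun w hw =>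
    hh w (Metric.ball_subset_closedBall hw.1)
  rcases S.eq_empty_or_nonempty with rfl | hne
  · simp only [Finset.prod_empty, div_one, Finset.sum_empty, mul_zero]
    exact Complex.circleIntegral_eq_zero_of_differentiable_on_off_countable hr
      Set.countable_empty hcont hdiff
  have hws : ∀ w ∈ Metric.sphere c r, ∀ n : ℤ, w ≠ (n : ℂ) := by
    rintro _ hw n rfl
    exact hS n hw
  have h1 : ∮ w in C(c, r), h w / ∏ n ∈ S, (w - (n : ℂ)) =
      ∮ w in C(c, r), ∑ s ∈ S, (∏ n ∈ S.erase s, ((s : ℂ) - n))⁻¹ * ((w - (s : ℂ))⁻¹ * h w) := by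
    refine circleIntegral.integral_congr hr fun w hw => ?_
    rw [div_eq_mul_inv, inv_prod_eq_sum hne fun n _ => hws w hw n, Finset.mul_sum]
    exact Finset.sum_congr rfl fun s _ => by ring
  rw [h1, circleIntegral.integral_fun_sum, Finset.mul_sum]
  · refine Finset.sum_congr rfl fun s _ => ?_
    rw [circleIntegral.integral_const_mul]
    split_ifs with hs
    · have := Complex.circleIntegral_sub_inv_smul_of_differentiable_on_off_countable
        Set.countable_empty hs hcont hdiff
      simp only [smul_eq_mul] at this
      rw [this]
      ring
    · have hout : ∀ w ∈ Metric.closedBall c r, w - (s : ℂ) ≠ 0 := by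
        intro w hw h0
        rw [sub_eq_zero] at h0
        rw [h0, ← Metric.ball_union_sphere] at hw
        exact hw.elim hs (hS s)
      rw [Complex.circleIntegral_eq_zero_of_differentiable_on_off_countable hr
        Set.countable_empty]
      · simp
      · exact ContinuousOn.mul (ContinuousOn.inv₀ (by fun_prop) hout) hcont
      · intro w hw
        exact ((by fun_prop : DifferentiableAt ℂ (fun w : ℂ => w - (s : ℂ)) w).inv
          (hout w (Metric.ball_subset_closedBall hw.1))).mul (hdiff w hw)
  · intro s _
    refine ContinuousOn.circleIntegrable hr ?_
    refine continuousOn_const.mul (ContinuousOn.mul (ContinuousOn.inv₀ (by fun_prop) ?_)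
      (hcont.mono Metric.sphere_subset_closedBall))
    exact fun w hw => sub_ne_zero.2 (hws w hw s)

/-! ### Factorials, binomials and Bernoulli weights in closed form. -/

lemma prod_range_erase_sub (m n : ℕ) (hmn : m ≤ n) :
    ∏ i ∈ (Finset.range (n + 1)).erase m, ((i : ℂ) - m) =
      (-1) ^ m * m.factorial * (n - m).factorial := by
  induction n, hmn using Nat.le_induction with
  | base =>
    have h1 : (Finset.range (m + 1)).erase m = Finset.range m := by
      ext i; simp; omega
    rw [h1, ← Finset.prod_range_reflect]
    have h2 : ∀ i ∈ Finset.range m, (((m - 1 - i : ℕ) : ℂ) - m) = (-1) * ((i + 1 : ℕ) : ℂ) := by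
      intro i hi
      have : ((m - 1 - i : ℕ) : ℂ) = m - 1 - i := by
        rw [Nat.cast_sub (by have := Finset.mem_range.1 hi; omega),
          Nat.cast_sub (by have := Finset.mem_range.1 hi; omega)]
        simp
      rw [this]
      push_cast
      ring
    rw [Finset.prod_congr rfl h2, Finset.prod_mul_distrib, ← Nat.cast_prod,
      Finset.prod_range_add_one_eq_factorial]
    simp
  | succ n hmn ih =>
    have h1 : (Finset.range (n + 1 + 1)).erase m =
        insert (n + 1) ((Finset.range (n + 1)).erase m) := by
      ext i; simp; omega
    rw [h1, Finset.prod_insert (by simp), ih, Nat.succ_sub hmn, Nat.factorial_succ]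
    push_cast [Nat.cast_sub hmn]
    ring

lemma prod_Icc_eq_prod_range {t : ℕ} {x : ℤ} (f : ℤ → ℂ) :
    ∏ n ∈ Finset.Icc (x - t) x, f n = ∏ i ∈ Finset.range (t + 1), f (x - i) := by
  symm
  refine Finset.prod_nbij (fun i : ℕ => x - i) ?_ ?_ ?_ (fun _ _ => rfl)
  · intro i hi
    simp at hi ⊢
    omega
  · intro i _ j _ h
    simp at h
    exact h
  · intro n hn
    simp at hn
    exact ⟨(x - n).toNat, by simp; omega, by simp; omega⟩

lemma poch_eq_prod_range (z : ℂ) (k : ℕ) : poch z k = ∏ i ∈ Finset.range k, (z + i) := by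
  induction k with
  | zero => simp [poch]
  | succ k ih => rw [Finset.prod_range_succ, ← ih, poch, ascPochhammer_succ_right]; simp [poch]

lemma poch_eq_prod (t : ℕ) (x : ℤ) (w : ℂ) :
    poch (w - x) (t + 1) = ∏ n ∈ Finset.Icc (x - t) x, (w - (n : ℂ)) := by
  rw [prod_Icc_eq_prod_range, poch_eq_prod_range]
  refine Finset.prod_congr rfl fun i _ => ?_
  push_cast
  ring

lemma prod_Icc_erase {t : ℕ} {x s : ℤ} (hs : s ∈ Finset.Icc (x - t) x) :
    ∏ n ∈ (Finset.Icc (x - t) x).erase s, ((s : ℂ) - n) =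
      (-1) ^ (x - s) * (t.factorial / (t.choose (x - s).toNat)) := by
  obtain ⟨hs1, hs2⟩ := Finset.mem_Icc.1 hs
  obtain ⟨m, hm⟩ : ∃ m : ℕ, x - s = m := ⟨(x - s).toNat, by omega⟩
  have hmt : m ≤ t := by omega
  have h1 : ∏ n ∈ (Finset.Icc (x - t) x).erase s, ((s : ℂ) - n) =
      ∏ i ∈ (Finset.range (t + 1)).erase m, ((i : ℂ) - m) := by
    symm
    refine Finset.prod_nbij (fun i : ℕ => x - i) ?_ ?_ ?_ ?_
    · intro i hi
      simp at hi ⊢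
      omega
    · intro i _ j _ h
      simp at h
      exact h
    · intro n hn
      simp at hn
      exact ⟨(x - n).toNat, by simp; omega, by simp; omega⟩
    · intro i _
      have : (s : ℂ) = x - m := by
        have : s = x - m := by omega
        rw [this]; push_cast; ring
      rw [this]
      push_cast
      ring
  rw [h1, prod_range_erase_sub m t hmt, hm, Int.toNat_natCast, zpow_natCast, mul_assoc]
  congr 1
  have h2 : (t.choose m : ℂ) * m.factorial * (t - m).factorial = t.factorial := by
    exact_mod_cast Nat.choose_mul_factorial_mul_factorial hmt
  have h3 : (t.choose m : ℂ) ≠ 0 := by exact_mod_cast (Nat.choose_pos hmt).ne'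
  rw [← h2]
  field_simp

/-- The binomial coefficient with an integer lower index. -/
def intChoose (t : ℕ) (d : ℤ) : ℂ := if 0 ≤ d then (t.choose d.toNat : ℂ) else 0

lemma intChoose_eq_zero {t : ℕ} {d : ℤ} (h : ¬ (0 ≤ d ∧ d ≤ t)) : intChoose t d = 0 := by
  rw [intChoose]
  split_ifs with h0
  · rw [Nat.choose_eq_zero_of_lt (by omega)]; simp
  · rfl

lemma intChoose_succ (t : ℕ) (d : ℤ) :
    intChoose (t + 1) d = intChoose t d + intChoose t (d - 1) := by
  rcases lt_trichotomy d 0 with h | rfl | h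
  · simp only [intChoose]
    rw [if_neg (by omega), if_neg (by omega), if_neg (by omega), add_zero]
  · simp [intChoose]
  · obtain ⟨m, rfl⟩ : ∃ m : ℕ, d = m + 1 := ⟨(d - 1).toNat, by omega⟩
    have h1 : ((m : ℤ) + 1).toNat = m + 1 := by omega
    simp only [intChoose, h1, add_sub_cancel_right, Int.toNat_natCast, h.le, Int.natCast_nonneg,
      if_true, Nat.choose_succ_succ]
    push_cast
    ring

lemma bernoulliWeight_eq {β : ℂ} (h0 : β ≠ 0) (h1 : 1 - β ≠ 0) (t : ℕ) (d : ℤ) :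
    bernoulliWeight β t d = intChoose t d * β ^ d * (1 - β) ^ ((t : ℤ) - d) := by
  induction t generalizing d with
  | zero =>
    by_cases hd : d = 0
    · subst hd; simp [bernoulliWeight, intChoose]
    · rw [intChoose_eq_zero (by simp; omega)]; simp [bernoulliWeight, hd]
  | succ t ih =>
    rw [bernoulliWeight, ih, ih, intChoose_succ]
    have e1 : ((t + 1 : ℕ) : ℤ) - d = (t - d) + 1 := by push_cast; ring
    have e2 : (t : ℤ) - (d - 1) = (t - d) + 1 := by ring
    rw [e1, e2, zpow_add_one₀ h1, zpow_sub_one₀ h0]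
    field_simp

/-! ### The w integral. -/

/-- The set `{x₁ - t₁, …, x₁} ∩ {a₁, …, a_N}` as a finset. -/
def poleSet {N : ℕ} (a : Weyl N) (t : ℕ) (x : ℤ) : Finset ℤ :=
  Finset.Icc (x - t) x ∩ Finset.univ.image a.1

lemma mem_poleSet {N : ℕ} {a : Weyl N} {t : ℕ} {x s : ℤ} :
    s ∈ poleSet a t x ↔ s ∈ wPoles a t x := by
  simp [poleSet, wPoles]

/-- The `w`-independent factor of the integrand. -/
def zFactor {N : ℕ} (a : Weyl N) (t : ℕ) (x : ℤ) (z : ℂ) : ℂ :=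
  poch (z - x + 1) (t - 1) / Complex.sin (Real.pi * z) * ∏ r, (z - (a.1 r : ℂ))

/-- The residue of the integrand at the integer `w = s`. -/
def residue {N : ℕ} (β : ℝ) (a : Weyl N) (t₁ : ℕ) (x₁ : ℤ) (t₂ : ℕ) (x₂ : ℤ) (z : ℂ) (s : ℤ) : ℂ :=
  zFactor a t₂ x₂ z * (((1 - β) / β : ℝ) : ℂ) ^ (s - z) / (s - z) * (Real.pi * (-1) ^ s) /
    ((∏ n ∈ (Finset.Icc (x₁ - t₁) x₁).erase s, ((s : ℂ) - n)) *
      ∏ n ∈ (Finset.univ.image a.1).erase s, ((s : ℂ) - n))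

section Residues

variable {N : ℕ} {β : ℝ} {a : Weyl N} {t₁ : ℕ} {x₁ : ℤ} {t₂ : ℕ} {x₂ : ℤ}

lemma sin_pi_int (n : ℤ) : Complex.sin (Real.pi * n) = 0 := by
  rw [mul_comm]; exact Complex.sin_int_mul_pi n

lemma cos_pi_int (n : ℤ) : Complex.cos (Real.pi * n) = (-1) ^ n := by
  rw [mul_comm, ← Complex.ofReal_intCast, ← Complex.ofReal_mul, ← Complex.ofReal_cos,
    Real.cos_int_mul_pi]
  push_cast
  rfl

lemma prod_sub_eq_prod_image (a : Weyl N) (w : ℂ) :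
    ∏ r, (w - (a.1 r : ℂ)) = ∏ n ∈ Finset.univ.image a.1, (w - (n : ℂ)) := by
  rw [Finset.prod_image a.2.injective.injOn]

/-- After removing the removable singularities, the integrand has simple poles at `poleSet`, with
explicit residues. -/
lemma exists_integrand_eq (β : ℝ) (hβ₀ : 0 < β) (hβ₁ : β < 1) (a : Weyl N) (t₁ : ℕ) (x₁ : ℤ)
    (t₂ : ℕ) (x₂ : ℤ) (z : ℂ) :
    ∃ h : ℂ → ℂ, (∀ w, w ≠ z → DifferentiableAt ℂ h w) ∧
      (∀ w : ℂ, (∀ n : ℤ, w ≠ n) → integrand β a t₁ x₁ t₂ x₂ z w =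
        h w / ∏ n ∈ poleSet a t₁ x₁, (w - (n : ℂ))) ∧
      ∀ s ∈ poleSet a t₁ x₁, h s / ∏ n ∈ (poleSet a t₁ x₁).erase s, ((s : ℂ) - n) =
        residue β a t₁ x₁ t₂ x₂ z s := by
  set I := Finset.Icc (x₁ - t₁) x₁
  set A := Finset.univ.image a.1
  have hsin : Differentiable ℂ fun w : ℂ => Complex.sin (Real.pi * w) := by fun_prop
  -- The denominator is the product over `I` times the product over `A`, that is, over `I ∪ A` times
  -- over `I ∩ A`. The sine cancels the zeros on the union, leaving simple poles on the
  -- intersection.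
  obtain ⟨g, hg, hsg⟩ := exists_eq_prod_mul hsin (I ∪ A) fun n _ => sin_pi_int n
  have hc0 : (((1 - β) / β : ℝ) : ℂ) ≠ 0 := by
    exact_mod_cast (div_pos (by linarith) hβ₀ : 0 < (1 - β) / β).ne'
  have hS : poleSet a t₁ x₁ = I ∩ A := rfl
  refine ⟨fun w => zFactor a t₂ x₂ z * (((1 - β) / β : ℝ) : ℂ) ^ (w - z) / (w - z) * g w,
    fun w hw => ?_, fun w hw => ?_, fun s hs => ?_⟩
  · have h1 : DifferentiableAt ℂ (fun w : ℂ => (((1 - β) / β : ℝ) : ℂ) ^ (w - z)) w :=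
      (differentiableAt_id.sub_const z).const_cpow (Or.inl hc0)
    have h2 : DifferentiableAt ℂ (fun w : ℂ => w - z) w := by fun_prop
    have h3 := (h1.const_mul (zFactor a t₂ x₂ z)).fun_div h2 (sub_ne_zero.2 hw)
    exact h3.fun_mul (hg w)
  · have hne : ∀ B : Finset ℤ, ∏ n ∈ B, (w - (n : ℂ)) ≠ 0 := fun B =>
      Finset.prod_ne_zero_iff.2 fun n _ => sub_ne_zero.2 (hw n)
    have hui := Finset.prod_union_inter (s₁ := I) (s₂ := A) (f := fun n : ℤ => w - (n : ℂ))
    have h1 := hne I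
    have h2 := hne A
    have h3 := hne (I ∩ A)
    rw [integrand, poch_eq_prod, Finset.prod_div_distrib, prod_sub_eq_prod_image a w, hsg w, hS,
      zFactor]
    -- In this case and the next, both sides are 0 by the convention for division by zero.
    by_cases hwz : w - z = 0
    · simp [hwz]
    by_cases hz : Complex.sin (Real.pi * z) = 0
    · simp [hz]
    change _ / (∏ n ∈ I, (w - (n : ℂ))) * _ * _ * _ * (_ / ∏ n ∈ A, (w - (n : ℂ))) = _
    generalize Complex.sin (Real.pi * z) = sz at hz ⊢
    rw [mul_comm _ (g w)]
    generalize ∏ n ∈ I, (w - (n : ℂ)) = pI at *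
    generalize ∏ n ∈ A, (w - (n : ℂ)) = pA at *
    generalize ∏ n ∈ I ∩ A, (w - (n : ℂ)) = pS at *
    generalize ∏ n ∈ I ∪ A, (w - (n : ℂ)) = pU at *
    field_simp
    linear_combination (poch (z - x₂ + 1) (t₂ - 1) * g w * (((1 - β) / β : ℝ) : ℂ) ^ (w - z) *
      ∏ r, (z - (a.1 r : ℂ))) * hui
  · have hsI : s ∈ I := (Finset.mem_inter.1 hs).1
    have hne : ∀ B : Finset ℤ, ∏ n ∈ B.erase s, ((s : ℂ) - (n : ℂ)) ≠ 0 := fun B =>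
      Finset.prod_ne_zero_iff.2 fun n hn => sub_ne_zero.2 fun h =>
        Finset.ne_of_mem_erase hn (Int.cast_injective h).symm
    have hui : (∏ n ∈ (I ∪ A).erase s, ((s : ℂ) - n)) * ∏ n ∈ (I ∩ A).erase s, ((s : ℂ) - n) =
        (∏ n ∈ I.erase s, ((s : ℂ) - n)) * ∏ n ∈ A.erase s, ((s : ℂ) - n) := by
      rw [← Finset.prod_union_inter (s₁ := I.erase s), Finset.erase_union_distrib]
      congr 2
      rw [Finset.erase_inter, Finset.inter_erase, Finset.erase_idem]
    -- Both sides are the derivative of sin(πw) at s, computed from the factorization and directly.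
    have hgs : (∏ n ∈ (I ∪ A).erase s, ((s : ℂ) - n)) * g s = Real.pi * (-1) ^ s := by
      have hd1 : HasDerivAt (fun w : ℂ => Complex.sin (Real.pi * w))
          (Complex.cos (Real.pi * s) * (Real.pi * 1)) (s : ℂ) :=
        ((hasDerivAt_id (s : ℂ)).const_mul (Real.pi : ℂ)).csin
      have hfun : (fun w : ℂ => Complex.sin (Real.pi * w)) =
          fun w => (w - s) * ((∏ n ∈ (I ∪ A).erase s, (w - (n : ℂ))) * g w) := by
        ext w
        rw [hsg w, ← Finset.mul_prod_erase (I ∪ A) _ (Finset.mem_union_left A hsI)]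
        ring
      have hdp : DifferentiableAt ℂ
          (fun w => (∏ n ∈ (I ∪ A).erase s, (w - (n : ℂ))) * g w) (s : ℂ) :=
        DifferentiableAt.mul (by fun_prop) (hg s)
      have hd2 := ((hasDerivAt_id (s : ℂ)).sub_const (s : ℂ)).mul hdp.hasDerivAt
      rw [hfun] at hd1
      have huniq := hd1.unique hd2
      simp only [id, sub_self, zero_mul, add_zero, one_mul, mul_one] at huniq
      rw [← huniq, cos_pi_int]
      ring
    rw [residue, hS, ← hui, ← hgs]
    have h1 := hne (I ∪ A)
    have h2 := hne (I ∩ A)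
    beta_reduce
    rw [div_eq_div_iff h2 (mul_ne_zero h1 h2)]
    ring

open Classical in
lemma circleIntegral_integrand (hβ₀ : 0 < β) (hβ₁ : β < 1) {z c : ℂ} {r : ℝ} (hr : 0 ≤ r)
    (hz : ∀ w ∈ Metric.closedBall c r, w ≠ z) (hn : ∀ n : ℤ, (n : ℂ) ∉ Metric.sphere c r) :
    CircleIntegrable (integrand β a t₁ x₁ t₂ x₂ z) c r ∧
    ∮ w in C(c, r), integrand β a t₁ x₁ t₂ x₂ z w =
      2 * Real.pi * Complex.I * ∑ s ∈ poleSet a t₁ x₁, if (s : ℂ) ∈ Metric.ball c r then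
        residue β a t₁ x₁ t₂ x₂ z s else 0 := by
  obtain ⟨h, hd, heq, hres⟩ := exists_integrand_eq β hβ₀ hβ₁ a t₁ x₁ t₂ x₂ z
  have heq' : ∀ w ∈ Metric.sphere c r, integrand β a t₁ x₁ t₂ x₂ z w =
      h w / ∏ n ∈ poleSet a t₁ x₁, (w - (n : ℂ)) := by
    intro w hw
    refine heq w ?_
    rintro n rfl
    exact hn n hw
  constructor
  · refine ContinuousOn.circleIntegrable hr ?_
    exact (continuousOn_div_prod (fun w hw => hd w (hz w hw)) hn).congr heq'
  · rw [circleIntegral.integral_congr hr heq',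
      circleIntegral_div_prod hr (fun w hw => hd w (hz w hw)) hn]
    congr 1
    refine Finset.sum_congr rfl fun s hs => ?_
    rw [hres s hs]

lemma linePoint_re (t : ℕ) (x : ℤ) (u : ℝ) : (linePoint t x u).re = x - t + 1 / 2 := by
  simp [linePoint]

lemma Circles.Admissible.circleIntegrable {γ : Circles} (hγ : γ.Admissible a t₁ x₁ t₂ x₂)
    (hβ₀ : 0 < β) (hβ₁ : β < 1) (u : ℝ) :
    CircleIntegrable (integrand β a t₁ x₁ t₂ x₂ (linePoint t₂ x₂ u)) γ.c₁ γ.r₁ ∧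
    CircleIntegrable (integrand β a t₁ x₁ t₂ x₂ (linePoint t₂ x₂ u)) γ.c₂ γ.r₂ := by
  refine ⟨(circleIntegral_integrand hβ₀ hβ₁ hγ.nonneg₁ ?_ hγ.avoids₁).1,
    (circleIntegral_integrand hβ₀ hβ₁ hγ.nonneg₂ ?_ hγ.avoids₂).1⟩
  · rintro w hw rfl
    have := hγ.left _ hw
    rw [linePoint_re] at this
    exact lt_irrefl _ this
  · rintro w hw rfl
    have := hγ.right _ hw
    rw [linePoint_re] at this
    exact lt_irrefl _ this

lemma Circles.Admissible.integral_integrand {γ : Circles} (hγ : γ.Admissible a t₁ x₁ t₂ x₂)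
    (hβ₀ : 0 < β) (hβ₁ : β < 1) (u : ℝ) :
    γ.integral (integrand β a t₁ x₁ t₂ x₂ (linePoint t₂ x₂ u)) =
      2 * Real.pi * Complex.I * ∑ s ∈ poleSet a t₁ x₁,
        residue β a t₁ x₁ t₂ x₂ (linePoint t₂ x₂ u) s := by
  rw [Circles.integral, (circleIntegral_integrand hβ₀ hβ₁ hγ.nonneg₁ ?_ hγ.avoids₁).2,
    (circleIntegral_integrand hβ₀ hβ₁ hγ.nonneg₂ ?_ hγ.avoids₂).2, ← mul_add,
    ← Finset.sum_add_distrib]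
  · congr 1
    refine Finset.sum_congr rfl fun s hs => ?_
    -- The z line separates the circles, so each pole is counted exactly once; the value is
    -- therefore the same for every admissible contour.
    have hnot : ¬ ((s : ℂ) ∈ Metric.ball γ.c₁ γ.r₁ ∧ (s : ℂ) ∈ Metric.ball γ.c₂ γ.r₂) :=
      fun h => lt_asymm (hγ.left _ (Metric.ball_subset_closedBall h.1))
        (hγ.right _ (Metric.ball_subset_closedBall h.2))
    rcases hγ.encircles s (mem_poleSet.1 hs) with h | h
    · rw [if_pos h, if_neg fun h' => hnot ⟨h, h'⟩, add_zero]
    · rw [if_pos h, if_neg fun h' => hnot ⟨h', h⟩, zero_add]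
  · rintro w hw rfl
    have := hγ.right _ hw
    rw [linePoint_re] at this
    exact lt_irrefl _ this
  · rintro w hw rfl
    have := hγ.left _ hw
    rw [linePoint_re] at this
    exact lt_irrefl _ this

lemma eval_lagrange (a : Weyl N) (j : Fin N) (z : ℂ) :
    (lagrange a j).eval z = (∏ r ∈ Finset.univ.erase j, (z - (a.1 r : ℂ))) /
      ∏ r ∈ Finset.univ.erase j, ((a.1 j : ℂ) - a.1 r) := by
  rw [lagrange, Lagrange.basis, Polynomial.eval_prod, ← Finset.prod_div_distrib]
  refine Finset.prod_congr rfl fun r _ => ?_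
  simp [Lagrange.basisDivisor]
  ring

/-- The factor z - a_j cancels the denominator a_j - z up to sign, and what remains of the product
is a Lagrange polynomial. The sum extends to all j because the binomial vanishes outside the window.
-/
lemma sum_residue_eq {z : ℂ} (hz : ∀ n : ℤ, (n : ℂ) ≠ z) :
    ∑ s ∈ poleSet a t₁ x₁, residue β a t₁ x₁ t₂ x₂ z s =
      -(Real.pi * (-1) ^ x₁ / t₁.factorial) * ∑ j, intChoose t₁ (x₁ - a.1 j) *
        ((((1 - β) / β : ℝ) : ℂ) ^ (a.1 j - z) * poch (z - x₂ + 1) (t₂ - 1) /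
          Complex.sin (Real.pi * z) * (lagrange a j).eval z) := by
  rw [poleSet, Finset.inter_comm, ← Finset.sum_ite_mem, Finset.sum_image a.2.injective.injOn,
    Finset.mul_sum]
  refine Finset.sum_congr rfl fun j _ => ?_
  split_ifs with hj
  · have hmem := Finset.mem_Icc.1 hj
    have hch : intChoose t₁ (x₁ - a.1 j) = t₁.choose (x₁ - a.1 j).toNat := by
      rw [intChoose, if_pos (by omega)]
    have hch0 : (t₁.choose (x₁ - a.1 j).toNat : ℂ) ≠ 0 := by
      exact_mod_cast (Nat.choose_pos (by omega)).ne'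
    have himg : (Finset.univ.image a.1).erase (a.1 j) = (Finset.univ.erase j).image a.1 :=
      (Finset.image_erase a.2.injective _ _).symm
    rw [residue, prod_Icc_erase hj, himg, Finset.prod_image a.2.injective.injOn, zFactor, hch,
      eval_lagrange, ← Finset.mul_prod_erase Finset.univ _ (Finset.mem_univ j)]
    have hne : ∏ r ∈ Finset.univ.erase j, ((a.1 j : ℂ) - a.1 r) ≠ 0 :=
      Finset.prod_ne_zero_iff.2 fun r hr => sub_ne_zero.2 fun h =>
        Finset.ne_of_mem_erase hr (injective_cast a h).symm
    have haz : (a.1 j : ℂ) - z ≠ 0 := sub_ne_zero.2 (hz _)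
    have hf : (t₁.factorial : ℂ) ≠ 0 := by exact_mod_cast t₁.factorial_ne_zero
    have hs : ((-1 : ℂ) ^ x₁) = (-1) ^ (x₁ - a.1 j) * (-1) ^ a.1 j := by
      rw [← zpow_add₀ (by norm_num)]; congr 1; ring
    have hs1 : ((-1 : ℂ) ^ (x₁ - a.1 j)) * (-1) ^ (x₁ - a.1 j) = 1 := by
      rw [← mul_zpow]; simp
    have hs0 : ((-1 : ℂ) ^ (x₁ - a.1 j)) ≠ 0 := left_ne_zero_of_mul_eq_one hs1
    rw [hs]
    generalize ((-1 : ℂ) ^ (x₁ - a.1 j)) = e at *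
    generalize Complex.sin (Real.pi * z) = sz at *
    generalize ∏ r ∈ Finset.univ.erase j, ((a.1 j : ℂ) - a.1 r) = pa at *
    have hz2 : z - (a.1 j : ℂ) = -((a.1 j : ℂ) - z) := by ring
    rw [hz2]
    field_simp
    rw [pow_two, hs1, mul_one]
  · rw [intChoose_eq_zero]
    · simp
    · rw [Finset.mem_Icc] at hj
      omega

end Residues

/-! ### Existence of an admissible contour. -/

section Circles

lemma dist_intCast_center (p q n : ℤ) :
    dist (n : ℂ) (((p + q : ℝ) / 2 : ℝ) : ℂ) = |(n : ℝ) - (p + q) / 2| := by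
  rw [Complex.dist_eq, ← Complex.ofReal_intCast, ← Complex.ofReal_sub, Complex.norm_real,
    Real.norm_eq_abs]

lemma intCast_notMem_sphere (p q n : ℤ) :
    (n : ℂ) ∉ Metric.sphere ((((p + q : ℝ) / 2 : ℝ)) : ℂ) ((q - p) / 2 + 1 / 4) := by
  rw [Metric.mem_sphere, dist_intCast_center]
  intro h
  rcases abs_choice ((n : ℝ) - (p + q) / 2) with h1 | h1
  · rw [h1] at h
    have h2 : (4 * n : ℝ) = 4 * q + 1 := by linarith
    have h3 : 4 * n = 4 * q + 1 := by exact_mod_cast h2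
    omega
  · rw [h1] at h
    have h2 : (4 * n : ℝ) = 4 * p - 1 := by linarith
    have h3 : 4 * n = 4 * p - 1 := by exact_mod_cast h2
    omega

lemma intCast_mem_ball {p q n : ℤ} (hp : p ≤ n) (hq : n ≤ q) :
    (n : ℂ) ∈ Metric.ball ((((p + q : ℝ) / 2 : ℝ)) : ℂ) ((q - p) / 2 + 1 / 4) := by
  rw [Metric.mem_ball, dist_intCast_center, abs_lt]
  have h1 : (p : ℝ) ≤ n := by exact_mod_cast hp
  have h2 : (n : ℝ) ≤ q := by exact_mod_cast hq
  constructor <;> linarith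

lemma abs_re_sub_le {w : ℂ} {c r : ℝ} (hw : w ∈ Metric.closedBall (c : ℂ) r) : |w.re - c| ≤ r := by
  rw [Metric.mem_closedBall, Complex.dist_eq] at hw
  simpa using (Complex.abs_re_le_norm (w - c)).trans hw

lemma exists_admissible {N : ℕ} (a : Weyl N) (t₁ : ℕ) (x₁ : ℤ) (t₂ : ℕ) (x₂ : ℤ) :
    ∃ γ : Circles, γ.Admissible a t₁ x₁ t₂ x₂ := by
  obtain ⟨m, hm⟩ : ∃ m : ℤ, m = x₂ - t₂ := ⟨_, rfl⟩
  have hm' : (x₂ : ℝ) - t₂ = m := by rw [hm]; push_cast; ring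
  obtain ⟨L, hL1, hL2⟩ : ∃ L : ℤ, L ≤ m ∧ L ≤ x₁ - t₁ := ⟨min m (x₁ - t₁), by omega, by omega⟩
  obtain ⟨M, hM1, hM2⟩ : ∃ M : ℤ, m + 1 ≤ M ∧ x₁ ≤ M := ⟨max (m + 1) x₁, by omega, by omega⟩
  have hL1' : (L : ℝ) ≤ m := by exact_mod_cast hL1
  have hM1' : ((m + 1 : ℤ) : ℝ) ≤ M := by exact_mod_cast hM1
  -- The diameters are [L - 1/4, m + 1/4] and [m + 3/4, M + 1/4]. They cover the whole window, leave
  -- the line Re z = m + 1/2 between them, and the quarter margins keep the circles off the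
  -- integers.
  refine ⟨⟨(((L + m : ℝ) / 2 : ℝ) : ℂ), (m - L) / 2 + 1 / 4,
    (((((m + 1 : ℤ) : ℝ) + M) / 2 : ℝ) : ℂ), (M - (m + 1 : ℤ)) / 2 + 1 / 4⟩,
    ⟨?_, ?_, ?_, ?_, ?_, ?_, ?_⟩⟩
  · dsimp only
    linarith
  · dsimp only
    linarith
  · intro w hw
    have := (abs_le.1 (abs_re_sub_le hw)).2
    rw [hm']
    linarith
  · intro w hw
    have := (abs_le.1 (abs_re_sub_le hw)).1
    rw [hm']
    push_cast at this
    linarith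
  · exact fun n => intCast_notMem_sphere L m n
  · exact fun n => intCast_notMem_sphere (m + 1) M n
  · rintro s ⟨hs, -⟩
    rw [Set.mem_Icc] at hs
    rcases le_or_gt s m with h | h
    · exact Or.inl (intCast_mem_ball (by omega) h)
    · exact Or.inr (intCast_mem_ball (by omega) (by omega))

end Circles

/-! ### The z integral as a combination of `inverseAvg`. -/

section Line

variable {N : ℕ} {β : ℝ} {a : Weyl N} {t₁ : ℕ} {x₁ : ℤ} {n : ℕ} {x₂ : ℤ} {γ : Circles}

lemma intCast_ne_linePoint (t : ℕ) (x : ℤ) (u : ℝ) (m : ℤ) : (m : ℂ) ≠ linePoint t x u := by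
  intro h
  have h1 := congrArg Complex.re h
  rw [linePoint_re, Complex.intCast_re] at h1
  have h2 : (2 * m : ℝ) = 2 * x - 2 * t + 1 := by linarith
  have h3 : 2 * m = 2 * x - 2 * t + 1 := by exact_mod_cast h2
  omega

lemma sin_linePoint (t : ℕ) (x : ℤ) (u : ℝ) :
    Complex.sin (Real.pi * linePoint t x u) =
      (-1) ^ (x - (t : ℤ)) * Complex.cosh (Real.pi * u) := by
  have h : (Real.pi * linePoint t x u : ℂ) =
      Real.pi * (((1 / 2 : ℝ) : ℂ) + u * Complex.I) + Real.pi * ((x - t : ℤ) : ℂ) := by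
    rw [linePoint]
    push_cast
    ring
  rw [h, Complex.sin_add, cos_pi_int, sin_pi_int, sin_pi_half_add]
  ring

/-- The constant in front of the line integrals. -/
def lineCoeff (β : ℝ) (a : Weyl N) (t₁ : ℕ) (x₁ : ℤ) (n : ℕ) (x₂ : ℤ) (j : Fin N) : ℂ :=
  2 * Real.pi * Complex.I * (-(Real.pi * (-1) ^ x₁ / t₁.factorial)) *
    intChoose t₁ (x₁ - a.1 j) * (((1 - β) / β : ℝ) : ℂ) ^ (a.1 j - x₂) *
      (-1) ^ (x₂ - (n + 1 : ℕ) : ℤ) * (2 * n.factorial)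

lemma Circles.Admissible.integral_linePoint (hγ : γ.Admissible a t₁ x₁ (n + 1) x₂)
    (hβ₀ : 0 < β) (hβ₁ : β < 1) (u : ℝ) :
    γ.integral (integrand β a t₁ x₁ (n + 1) x₂ (linePoint (n + 1) x₂ u)) =
      ∑ j, lineCoeff β a t₁ x₁ n x₂ j *
        ((fun v : ℂ => poch (v + 1) n / n.factorial * (lagrange a j).eval (x₂ + v) *
          (((1 - β) / β : ℝ) : ℂ) ^ (-v)) (((-(n : ℝ) - 1 / 2 : ℝ) : ℂ) + u * Complex.I) /
            (2 * Complex.cosh (Real.pi * u))) := by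
  have hc0 : (((1 - β) / β : ℝ) : ℂ) ≠ 0 := by
    exact_mod_cast (div_pos (by linarith) hβ₀ : 0 < (1 - β) / β).ne'
  rw [hγ.integral_integrand hβ₀ hβ₁, sum_residue_eq (intCast_ne_linePoint (n + 1) x₂ u),
    ← mul_assoc, Finset.mul_sum]
  refine Finset.sum_congr rfl fun j _ => ?_
  set v : ℂ := ((-(n : ℝ) - 1 / 2 : ℝ) : ℂ) + u * Complex.I with hv
  -- Substituting z = x₂ + v moves the line to Re v = -n - 1/2, the line of `inverseAvg`.
  have hlp : linePoint (n + 1) x₂ u = x₂ + v := by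
    rw [hv, linePoint]; push_cast; ring
  have hpow : (((1 - β) / β : ℝ) : ℂ) ^ ((a.1 j : ℂ) - (x₂ + v)) =
      (((1 - β) / β : ℝ) : ℂ) ^ (a.1 j - x₂) * (((1 - β) / β : ℝ) : ℂ) ^ (-v) := by
    rw [← Complex.cpow_intCast, ← Complex.cpow_add _ _ hc0]
    congr 1
    push_cast
    ring
  have hsign : ∀ m : ℤ, ((-1 : ℂ) ^ m) * (-1) ^ m = 1 := fun m => by rw [← mul_zpow]; simp
  have hs1 := hsign (x₂ - (n + 1 : ℕ))
  have hs0 := left_ne_zero_of_mul_eq_one hs1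
  have hf : (n.factorial : ℂ) ≠ 0 := by exact_mod_cast n.factorial_ne_zero
  have hch := cosh_ofReal_ne_zero u
  rw [sin_linePoint, hlp, hpow, lineCoeff, Nat.add_sub_cancel,
    (by ring : (x₂ : ℂ) + v - x₂ + 1 = v + 1)]
  beta_reduce
  generalize ((-1 : ℂ) ^ (x₂ - ((n + 1 : ℕ) : ℤ))) = e at *
  generalize Complex.cosh (Real.pi * u) = ch at *
  generalize (((1 - β) / β : ℝ) : ℂ) ^ (-v) = cv at *
  generalize (((1 - β) / β : ℝ) : ℂ) ^ (a.1 j - x₂) = ca at *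
  field_simp
  rw [pow_two, hs1, mul_one]

lemma Circles.Admissible.converges (hγ : γ.Admissible a t₁ x₁ (n + 1) x₂)
    (hβ₀ : 0 < β) (hβ₁ : β < 1) : Converges β a γ t₁ x₁ (n + 1) x₂ := by
  have hc : 0 < (1 - β) / β := div_pos (by linarith) hβ₀
  refine ⟨fun u => hγ.circleIntegrable hβ₀ hβ₁ u, ?_⟩
  simp only [hγ.integral_linePoint hβ₀ hβ₁]
  exact integrable_finsetSum _ fun j _ =>
    ((tame_poch_mul_eval (lagrange a j) hc n 1 x₂ n.factorial).integrable_line _).const_mul _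

lemma Circles.Admissible.integral_line (hγ : γ.Admissible a t₁ x₁ (n + 1) x₂)
    (hβ₀ : 0 < β) (hβ₁ : β < 1) :
    ∫ u : ℝ, γ.integral (integrand β a t₁ x₁ (n + 1) x₂ (linePoint (n + 1) x₂ u)) * Complex.I =
      (∑ j, lineCoeff β a t₁ x₁ n x₂ j * inverseAvg ((1 - β) / β) (lagrange a j) n x₂) *
        Complex.I := by
  have hc : 0 < (1 - β) / β := div_pos (by linarith) hβ₀
  simp only [hγ.integral_linePoint hβ₀ hβ₁]
  rw [integral_mul_const, integral_finsetSum _ fun j _ =>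
    ((tame_poch_mul_eval (lagrange a j) hc n 1 x₂ n.factorial).integrable_line _).const_mul _]
  congr 1
  refine Finset.sum_congr rfl fun j _ => ?_
  rw [integral_const_mul]
  rfl

end Line

/-! ### Conjugation and comparison of the kernels. -/

/-- The conjugating factor between `preKernel` and `kernel`. -/
def gauge (β : ℝ) (t : ℕ) (x : ℤ) : ℂ :=
  (-1) ^ x * (((1 - β) / β : ℝ) : ℂ) ^ x / (1 - β : ℂ) ^ t

/-- The correlation kernel at all times. -/
def walkKernel {N : ℕ} (β : ℝ) (a : Weyl N) (t₁ : ℕ) (x₁ : ℤ) (t₂ : ℕ) (x₂ : ℤ) : ℂ :=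
  gauge β t₁ x₁ * preKernel β a.1 (biorth β a) t₁ x₁ t₂ x₂ * (gauge β t₂ x₂)⁻¹

lemma gauge_ne_zero {β : ℝ} (hβ₀ : 0 < β) (hβ₁ : β < 1) (t : ℕ) (x : ℤ) : gauge β t x ≠ 0 := by
  have hc0 : (((1 - β) / β : ℝ) : ℂ) ≠ 0 := by
    exact_mod_cast (div_pos (by linarith) hβ₀ : 0 < (1 - β) / β).ne'
  have hb : (1 - β : ℂ) ≠ 0 := by
    have : (1 - β : ℝ) ≠ 0 := by linarith
    exact_mod_cast this
  exact div_ne_zero (mul_ne_zero (zpow_ne_zero _ (by norm_num)) (zpow_ne_zero _ hc0))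
    (pow_ne_zero _ hb)

lemma det_conj {k : ℕ} (g : Fin k → ℂ) (hg : ∀ i, g i ≠ 0) (M : Matrix (Fin k) (Fin k) ℂ) :
    Matrix.det (Matrix.of fun i j => g i * M i j * (g j)⁻¹) = M.det := by
  have h : (Matrix.of fun i j => g i * M i j * (g j)⁻¹) =
      Matrix.of fun i j => g i * (Matrix.of fun i j => (g j)⁻¹ * M i j) i j := by
    ext i j
    simp
    ring
  rw [h, Matrix.det_mul_column, Matrix.det_mul_row, ← mul_assoc, ← Finset.prod_mul_distrib]
  simp [hg]

lemma IsWalk.isDeterminantal_walkKernel {N : ℕ} {β : ℝ} {a : Weyl N} {Ω : Type*}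
    [MeasurableSpace Ω] {P : Measure Ω} [IsProbabilityMeasure P] {X : ℕ → Ω → Weyl N}
    (hX : IsWalk β a P X) (hβ₀ : 0 < β) (hβ₁ : β < 1) :
    IsDeterminantal P X (walkKernel β a) := by
  intro k t y hty
  rw [hX.isDeterminantal_preKernel hβ₀ hβ₁ (exists_biorth_eq_sum hβ₀ hβ₁ a)
    (avg_biorth hβ₀ hβ₁ a) (biorth_zero β a) k t y hty]
  exact (det_conj (fun i => gauge β (t i) (y i)) (fun i => gauge_ne_zero hβ₀ hβ₁ _ _)
    (Matrix.of fun i j => preKernel β a.1 (biorth β a) (t i) (y i) (t j) (y j))).symm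

/-- The factor is chosen to cancel all powers of β and 1 - β, leaving the signed binomial of the
first term of the kernel. -/
lemma gauge_mul_bernoulliWeight {β : ℝ} (hβ₀ : 0 < β) (hβ₁ : β < 1) (t : ℕ) (d : ℤ) :
    gauge β t d * bernoulliWeight β t d = (-1) ^ d * intChoose t d := by
  have h0 : (β : ℂ) ≠ 0 := by exact_mod_cast hβ₀.ne'
  have h1 : (1 - β : ℂ) ≠ 0 := by
    have : (1 - β : ℝ) ≠ 0 := by linarith
    exact_mod_cast this
  rw [bernoulliWeight_eq h0 h1, gauge, zpow_sub₀ h1, zpow_natCast]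
  push_cast
  rw [div_zpow]
  have h2 := zpow_ne_zero d h0
  have h3 := zpow_ne_zero d h1
  have h4 := pow_ne_zero t h1
  generalize (β : ℂ) ^ d = b at *
  generalize (1 - β : ℂ) ^ d = b' at *
  generalize (1 - β : ℂ) ^ t = b'' at *
  field_simp

lemma gauge_div {β : ℝ} (hβ₀ : 0 < β) (hβ₁ : β < 1) {t₁ t₂ : ℕ} (ht : t₂ ≤ t₁) (x₁ x₂ : ℤ) :
    gauge β t₁ x₁ * (gauge β t₂ x₂)⁻¹ = gauge β (t₁ - t₂) (x₁ - x₂) := by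
  have hc0 : (((1 - β) / β : ℝ) : ℂ) ≠ 0 := by
    exact_mod_cast (div_pos (by linarith) hβ₀ : 0 < (1 - β) / β).ne'
  have h1 : (1 - β : ℂ) ≠ 0 := by
    have : (1 - β : ℝ) ≠ 0 := by linarith
    exact_mod_cast this
  obtain ⟨d, rfl⟩ := Nat.exists_eq_add_of_le ht
  rw [Nat.add_sub_cancel_left, gauge, gauge, gauge, zpow_sub₀ hc0, zpow_sub₀ (by norm_num), pow_add]
  have h2 := zpow_ne_zero x₂ hc0
  have h3 : ((-1 : ℂ) ^ x₂) ≠ 0 := zpow_ne_zero x₂ (by norm_num)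
  field_simp

lemma lineCoeff_mul_inverseAvg {N : ℕ} {β : ℝ} (hβ₀ : 0 < β) (hβ₁ : β < 1) (a : Weyl N)
    (t₁ : ℕ) (x₁ : ℤ) (n : ℕ) (x₂ : ℤ) (j : Fin N) :
    (t₁.factorial : ℂ) / n.factorial * (1 / (2 * Real.pi * Complex.I) ^ 2) *
        (lineCoeff β a t₁ x₁ n x₂ j * inverseAvg ((1 - β) / β) (lagrange a j) n x₂ * Complex.I) =
      gauge β t₁ x₁ * (bernoulliWeight β t₁ (x₁ - a.1 j) * biorth β a (n + 1) j x₂) *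
        (gauge β (n + 1) x₂)⁻¹ := by
  have hc0 : (((1 - β) / β : ℝ) : ℂ) ≠ 0 := by
    exact_mod_cast (div_pos (by linarith) hβ₀ : 0 < (1 - β) / β).ne'
  have h1 : (1 - β : ℂ) ≠ 0 := by
    have : (1 - β : ℝ) ≠ 0 := by linarith
    exact_mod_cast this
  have hg : gauge β t₁ x₁ * bernoulliWeight β t₁ (x₁ - a.1 j) =
      (-1) ^ x₁ * (((1 - β) / β : ℝ) : ℂ) ^ (a.1 j) * intChoose t₁ (x₁ - a.1 j) := by
    have hm := gauge_mul_bernoulliWeight hβ₀ hβ₁ t₁ (x₁ - a.1 j)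
    have hs : gauge β t₁ x₁ = gauge β t₁ (x₁ - a.1 j) * ((-1) ^ (a.1 j) *
        (((1 - β) / β : ℝ) : ℂ) ^ (a.1 j)) := by
      rw [gauge, gauge, zpow_sub₀ hc0, zpow_sub₀ (by norm_num)]
      have h2 := zpow_ne_zero (a.1 j) hc0
      have h3 : ((-1 : ℂ) ^ a.1 j) ≠ 0 := zpow_ne_zero _ (by norm_num)
      field_simp
    rw [hs, mul_right_comm, hm, zpow_sub₀ (by norm_num)]
    have h3 : ((-1 : ℂ) ^ a.1 j) ≠ 0 := zpow_ne_zero _ (by norm_num)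
    field_simp
  rw [← mul_assoc (gauge β t₁ x₁), hg, biorth, gauge, lineCoeff, zpow_sub₀ hc0,
    zpow_sub₀ (by norm_num), zpow_natCast, pow_succ (-1 : ℂ)]
  have h2 := zpow_ne_zero x₂ hc0
  have hs1 : ((-1 : ℂ) ^ x₂) * (-1) ^ x₂ = 1 := by rw [← mul_zpow]; simp
  have hs2 : ((-1 : ℂ) ^ n) * (-1) ^ n = 1 := by rw [← mul_pow]; simp
  have h3 := left_ne_zero_of_mul_eq_one hs1
  have h4 := left_ne_zero_of_mul_eq_one hs2
  have h5 := pow_ne_zero (n + 1) h1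
  have hf : (n.factorial : ℂ) ≠ 0 := by exact_mod_cast n.factorial_ne_zero
  have hf1 : (t₁.factorial : ℂ) ≠ 0 := by exact_mod_cast t₁.factorial_ne_zero
  have hpi : (Real.pi : ℂ) ≠ 0 := by exact_mod_cast Real.pi_pos.ne'
  generalize (((1 - β) / β : ℝ) : ℂ) ^ x₂ = C2 at *
  generalize (((1 - β) / β : ℝ) : ℂ) ^ a.1 j = Ca at *
  generalize (-1 : ℂ) ^ x₂ = e2 at *
  generalize (-1 : ℂ) ^ n = en at *
  generalize (-1 : ℂ) ^ x₁ = e1 at *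
  generalize (1 - β : ℂ) ^ (n + 1) = B at *
  generalize inverseAvg ((1 - β) / β) (lagrange a j) n x₂ = V at *
  have hI := Complex.I_ne_zero
  field_simp
  rw [pow_two e2, hs1, pow_two en, hs2]

theorem walkKernel_eq_kernel {N : ℕ} {β : ℝ} (hβ₀ : 0 < β) (hβ₁ : β < 1) {a : Weyl N}
    {t₁ : ℕ} {x₁ : ℤ} {n : ℕ} {x₂ : ℤ} {γ : Circles} (hγ : γ.Admissible a t₁ x₁ (n + 1) x₂) :
    walkKernel β a t₁ x₁ (n + 1) x₂ = kernel β a γ t₁ x₁ (n + 1) x₂ := by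
  rw [walkKernel, kernel, preKernel, hγ.integral_line hβ₀ hβ₁, mul_sub, sub_mul, Finset.mul_sum,
    Finset.sum_mul, Finset.sum_mul, Finset.mul_sum, Nat.add_sub_cancel]
  simp only [lineCoeff_mul_inverseAvg hβ₀ hβ₁]
  rw [sub_eq_neg_add]
  congr 1
  by_cases ht : n + 1 < t₁
  · rw [if_pos ht, mul_right_comm, gauge_div hβ₀ hβ₁ ht.le, gauge_mul_bernoulliWeight hβ₀ hβ₁]
    by_cases hx : x₂ ≤ x₁
    · rw [if_pos ⟨hx, ht⟩, intChoose, if_pos (by omega), zpow_add_one₀ (by norm_num)]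
      ring
    · rw [if_neg fun h => hx h.1, intChoose, if_neg (by omega)]
      simp
  · rw [if_neg ht, if_neg fun h => ht h.2]
    simp

end

end NoncollidingBernoulli

open NoncollidingBernoulli in
theorem theorem2p1 {N : ℕ} (β : ℝ) (hβ₀ : 0 < β) (hβ₁ : β < 1) (a : Weyl N)
    {Ω : Type*} [MeasurableSpace Ω] (P : MeasureTheory.Measure Ω)
    [MeasureTheory.IsProbabilityMeasure P] (X : ℕ → Ω → Weyl N) (hX : IsWalk β a P X) :
    ∃ K : ℕ → ℤ → ℕ → ℤ → ℂ,
      IsDeterminantal P X K ∧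
      ∀ (t₁ t₂ : ℕ) (x₁ x₂ : ℤ), 1 ≤ t₁ → 1 ≤ t₂ →
        (∃ γ : Circles, γ.Admissible a t₁ x₁ t₂ x₂) ∧
        ∀ γ : Circles, γ.Admissible a t₁ x₁ t₂ x₂ →
          Converges β a γ t₁ x₁ t₂ x₂ ∧
          K t₁ x₁ t₂ x₂ = kernel β a γ t₁ x₁ t₂ x₂ := by
  refine ⟨walkKernel β a, hX.isDeterminantal_walkKernel hβ₀ hβ₁, fun t₁ t₂ x₁ x₂ _ ht₂ => ?_⟩
  -- Positive t₂ selects the line integral branch of `biorth`; at time 0 the kernel uses the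
  -- Lagrange polynomials themselves.
  obtain ⟨n, rfl⟩ : ∃ n, t₂ = n + 1 := ⟨t₂ - 1, by omega⟩
  exact ⟨exists_admissible a t₁ x₁ (n + 1) x₂, fun γ hγ =>
    ⟨hγ.converges hβ₀ hβ₁, walkKernel_eq_kernel hβ₀ hβ₁ hγ⟩⟩
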